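/- **Theorem (Strong consistency).** Let $\Theta\subset\mathbb R^r$, $\theta_0\in\Theta$, and let $\sigma:\mathbb R^\infty\times\Theta\to(0,\infty)$ be measurable in its first argument. Let $(\epsilon_t)_{t\in\mathbb Z}$, $(\eta_t)_{t\in\mathbb Z}$ be real random variables on a probability space, let $\tilde\epsilon_t$, $t\le 0$, be arbitrary (constant or random) presample values, and put $$\sigma_t(\theta)=\sigma(\epsilon_{t-1},\epsilon_{t-2},\dots;\theta),\qquad \tilde\sigma_t(\theta)=\sigma(\epsilon_{t-1},\dots,\epsilon_1,\tilde\epsilon_0,\tilde\epsilon_{-1},\dots;\theta).$$ Let $\mathcal F_t$ be the $\sigma$-algebra generated by $\{\epsilon_u:u\le t\}$. Assume: 1. $\Theta$ is compact. 2. $(\epsilon_t)$ is a strictly stationary and ergodic solution of $\epsilon_t=\sigma_t(\theta_0)\eta_t$, $t\in\mathbb Z$. 3. For every real sequence $(x_i)$, $\theta\mapsto\sigma(x_1,x_2,\dots;\theta)$ is continuous on $\Theta$. There is a constant $\underline\omega>0$ such that, almost surely, $\sigma_t(\theta)>\underline\omega$ for all $\theta\in\Theta$; $\mathbb E[\sigma_t(\theta_0)^s]<\infty$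 for some $s>0$; and for every $\theta\in\Theta$, $\sigma_t(\theta_0)/\sigma_t(\theta)=1$ almost surely if and only if $\theta=\theta_0$. 4. There are $\rho\in(0,1)$ and an $\mathcal F_0$-measurable random variable $C_1$ with $\mathbb E[|C_1|^s]<\infty$ for some $s>0$ such that, almost surely, $\sup_{\theta\in\Theta}|\sigma_t(\theta)-\tilde\sigma_t(\theta)|\le C_1\rho^t$ for all $t\ge1$. 5. The $\eta_t$ are iid with continuous cdf $F$, $\mathbb E[\eta_t^2]=1$, and $\eta_t$ is independent of $\{\epsilon_u:u<t\}$ for every $t$. For $n\ge1$ let $\hat\theta_n$ be a measurable solution of $\hat\theta_n=\arg\max_{\theta\in\Theta}\tilde L_n(\theta)$, where $$\tilde L_n(\theta)=\frac1n\sum_{t=1}^n\Big\{-\frac12\Big(\frac{\epsilon_t}{\tilde\sigma_t(\theta)}\Big)^2-\log\tilde\sigma_t(\theta)\Big\}.$$ Then $\hat\theta_n\to\theta_0$ almost surely. Assume in addition that $\theta_0$ is an interior point of $\Theta$ and that there is a neighbourhood $\mathscr V\subset\Theta$ of $\theta_0$ with $\mathbb E\big[\sup_{\theta\in\mathscr V}\sigma_t(\theta)/\sigma_t(\theta_0)\big]<\infty$.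 Let $\hat\eta_t=\epsilon_t/\tilde\sigma_t(\hat\theta_n)$, $1\le t\le n$, be the residuals and $\hat{\mathbb F}_n(x)=\frac1n\sum_{t=1}^n\mathbf 1\{\hat\eta_t\le x\}$. Then $\sup_{x\in\mathbb R}|\hat{\mathbb F}_n(x)-F(x)|\to0$ almost surely. Moreover, let $\alpha\in(0,1)$ and $\xi_\alpha=F^{-1}(\alpha)=\inf\{\tau:F(\tau)\ge\alpha\}$, and suppose that this quantile is unique, that is, $F(x)>\alpha$ for all $x>\xi_\alpha$. Then every sequence of empirical $\alpha$-quantiles $$\hat\xi_{n,\alpha}\in\arg\min_{z\in\mathbb R}\frac1n\sum_{t=1}^n\rho_\alpha(\hat\eta_t-z),\qquad \rho_\alpha(u)=u(\alpha-\mathbf 1\{u<0\}),$$ and in particular the choice $\hat\xi_{n,\alpha}=\hat{\mathbb F}_n^{-1}(\alpha)=\inf\{\tau:\hat{\mathbb F}_n(\tau)\ge\alpha\}$, converges almost surely to $\xi_\alpha$. -/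

import Mathlib

open MeasureTheory ProbabilityTheory Filter Topology

noncomputable section

variable {Ω : Type*} {r : ℕ}

/-- The sigma-algebra `𝓕_t` generated by the observations `ε_u`, `u ≤ t`. -/
@[reducible] def pastSigma (ε : ℤ → Ω → ℝ) (t : ℤ) : MeasurableSpace Ω :=
  ⨆ u ∈ Set.Iic t, MeasurableSpace.comap (ε u) inferInstance

/-- The process `(ε_t)`, `t ∈ ℤ`, is strictly stationary and ergodic: the left shift on `ℝ^ℤ`
preserves the law of the process and is ergodic for it (Mathlib's `Ergodic` contains
`MeasurePreserving`). -/
def StationaryErgodic [MeasurableSpace Ω] (P : Measure Ω) (ε : ℤ → Ω → ℝ) : Prop :=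
  Ergodic (fun (x : ℤ → ℝ) (t : ℤ) => x (t + 1)) (P.map fun ω t => ε t ω)

/-- `σ_t(θ) = σ(ε_{t-1}, ε_{t-2}, …; θ)`. -/
def vol (σ : (ℕ → ℝ) → EuclideanSpace ℝ (Fin r) → ℝ) (ε : ℤ → Ω → ℝ)
    (t : ℤ) (θ : EuclideanSpace ℝ (Fin r)) (ω : Ω) : ℝ :=
  σ (fun i : ℕ => ε (t - 1 - i) ω) θ

/-- `σ̃_t(θ) = σ(ε_{t-1}, …, ε_1, ε̃_0, ε̃_{-1}, …; θ)`: the presample observations `ε_u`, `u ≤ 0`,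
are replaced by `ε̃_u`. -/
def volTilde (σ : (ℕ → ℝ) → EuclideanSpace ℝ (Fin r) → ℝ) (ε εtilde : ℤ → Ω → ℝ)
    (t : ℤ) (θ : EuclideanSpace ℝ (Fin r)) (ω : Ω) : ℝ :=
  σ (fun i : ℕ => if 1 ≤ t - 1 - (i : ℤ) then ε (t - 1 - i) ω else εtilde (t - 1 - i) ω) θ

/-- The Gaussian quasi-log-likelihood `L̃_n(θ) = n⁻¹ ∑_{t=1}^n ℓ̃_t(θ)` with
`ℓ̃_t(θ) = -(1/2) (ε_t / σ̃_t(θ))² - log σ̃_t(θ)`. -/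
def quasiLogLik (σ : (ℕ → ℝ) → EuclideanSpace ℝ (Fin r) → ℝ) (ε εtilde : ℤ → Ω → ℝ)
    (n : ℕ) (θ : EuclideanSpace ℝ (Fin r)) (ω : Ω) : ℝ :=
  (1 / (n : ℝ)) * ∑ t ∈ Finset.Icc 1 n,
    (-(1 / 2 : ℝ) * (ε t ω / volTilde σ ε εtilde t θ ω) ^ 2
      - Real.log (volTilde σ ε εtilde t θ ω))

/-- `θhat n`, `n ≥ 1`, is a measurable solution of `θhat n = argmax_{θ ∈ Θ} L̃_n(θ)`. -/
def IsGaussianQMLE [MeasurableSpace Ω] (Θ : Set (EuclideanSpace ℝ (Fin r)))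
    (σ : (ℕ → ℝ) → EuclideanSpace ℝ (Fin r) → ℝ) (ε εtilde : ℤ → Ω → ℝ)
    (θhat : ℕ → Ω → EuclideanSpace ℝ (Fin r)) : Prop :=
  ∀ n : ℕ, 1 ≤ n → Measurable (θhat n) ∧
    ∀ ω, θhat n ω ∈ Θ ∧ IsMaxOn (fun θ => quasiLogLik σ ε εtilde n θ ω) Θ (θhat n ω)

/-- The residual `η̂_t = ε_t / σ̃_t(θ̂_n)` (it depends on `n` through the estimator). -/
def qmlResidual (σ : (ℕ → ℝ) → EuclideanSpace ℝ (Fin r) → ℝ) (ε εtilde : ℤ → Ω → ℝ)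
    (θhat : ℕ → Ω → EuclideanSpace ℝ (Fin r)) (n : ℕ) (t : ℤ) (ω : Ω) : ℝ :=
  ε t ω / volTilde σ ε εtilde t (θhat n ω) ω

/-- The empirical distribution function `n⁻¹ ∑_{t=1}^n 1{η̂_t ≤ x}` of the residuals. -/
def residualEdf (σ : (ℕ → ℝ) → EuclideanSpace ℝ (Fin r) → ℝ) (ε εtilde : ℤ → Ω → ℝ)
    (θhat : ℕ → Ω → EuclideanSpace ℝ (Fin r)) (n : ℕ) (ω : Ω) (x : ℝ) : ℝ :=
  (1 / (n : ℝ)) * ∑ t ∈ Finset.Icc 1 n,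
    Set.indicator (Set.Iic x) (fun _ => (1 : ℝ)) (qmlResidual σ ε εtilde θhat n t ω)

/-- The asymmetric absolute loss `ρ_α(u) = u (α - 1{u < 0})`. -/
def checkLoss (α u : ℝ) : ℝ :=
  u * (α - Set.indicator (Set.Iio 0) (fun _ => (1 : ℝ)) u)

/-- `ξhat n`, `n ≥ 1`, is an empirical `α`-quantile of the residuals: a minimizer over `z ∈ ℝ` of
`n⁻¹ ∑_{t=1}^n ρ_α(η̂_t - z)`. -/
def IsResidualQuantile (σ : (ℕ → ℝ) → EuclideanSpace ℝ (Fin r) → ℝ) (ε εtilde : ℤ → Ω → ℝ)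
    (θhat : ℕ → Ω → EuclideanSpace ℝ (Fin r)) (α : ℝ) (ξhat : ℕ → Ω → ℝ) : Prop :=
  ∀ n : ℕ, 1 ≤ n → ∀ ω,
    IsMinOn (fun z : ℝ => (1 / (n : ℝ)) * ∑ t ∈ Finset.Icc 1 n,
      checkLoss α (qmlResidual σ ε εtilde θhat n t ω - z)) Set.univ (ξhat n ω)

/-- The generalized inverse `G⁻¹(u) = inf {τ : G(τ) ≥ u}`. -/
def genInv (G : ℝ → ℝ) (u : ℝ) : ℝ := sInf {τ : ℝ | u ≤ G τ}

end

/-! Consistency is Wald's argument. Put R = σ_t(θ₀)/σ_t(θ), which is independent of η_t. When the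
expected log-likelihood at θ is finite, it exceeds the one at θ₀ by E[-R²/2 + 1/2 + log R], which is
negative unless R = 1 a.s., because log R² ≤ R² - 1 with equality only at 1
(`integral_gaussLogLik_lt`). The expectation may also be -∞, so local suprema of the likelihood are
truncated from below; on a small ball around θ their mean still stays under the value at θ₀
(`exists_integral_max_localSup_lt`). Ergodic averages then expel the estimator from that ball, and
compactness of Θ concludes. Presample values are harmless: their effect decays geometrically while
ε_t² grows at most polynomially, so its Cesàro means vanish. Only one-sided Birkhoff bounds are
needed, and they come from running maxima of Birkhoff sums.

A residual is ε_t/σ_t(θ₀), almost surely η_t, divided by a factor close to 1. Its indicator at level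
y is therefore squeezed between stationary indicators with thresholds y ± |y|·(deviation of the
volatility near θ₀), up to finitely many t. Ergodic averages apply for each fixed ball; as the ball
shrinks, continuity of F makes both bounds tend to F(y) (`ae_tendsto_average_indicator`). Pólya's
argument gives uniformity. Check-loss minimizers and generalized inverses are both quantiles in the
sense of `IsQuantileOf`, and uniqueness of the limit quantile forces convergence
(`tendsto_quantile`). -/

/-! ### One-sided pointwise ergodic theorem. -/

/-- The running maxima `max (0, S₁, …, Sₙ)` of the Birkhoff sums of `f`, defined recursively. -/
def birkhoffMax {X : Type*} (T : X → X) (f : X → ℝ) : ℕ → X → ℝ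
  | 0 => fun _ => 0
  | n + 1 => fun x => max 0 (f x + birkhoffMax T f n (T x))

section BirkhoffMax

variable {X : Type*} {T : X → X} {f : X → ℝ}

lemma birkhoffMax_nonneg (n : ℕ) (x : X) : 0 ≤ birkhoffMax T f n x := by
  cases n with
  | zero => exact le_rfl
  | succ n => exact le_max_left _ _

lemma birkhoffMax_le_succ (n : ℕ) (x : X) :
    birkhoffMax T f n x ≤ birkhoffMax T f (n + 1) x := by
  induction n generalizing x with
  | zero => exact birkhoffMax_nonneg 1 x
  | succ n ih =>
    have := ih (T x)
    exact max_le_max le_rfl (by linarith)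

lemma monotone_birkhoffMax (x : X) : Monotone fun n => birkhoffMax T f n x :=
  monotone_nat_of_le_succ fun n => birkhoffMax_le_succ n x

lemma birkhoffSum_le_birkhoffMax (n : ℕ) (x : X) :
    birkhoffSum T f n x ≤ birkhoffMax T f n x := by
  induction n generalizing x with
  | zero => simp [birkhoffMax]
  | succ n ih =>
    rw [birkhoffSum_succ']
    exact le_max_of_le_right (by linarith [ih (T x)])

/-- The recursion shifts the maxima only by the finite amount `f x`, so the set of boundedness is
exactly `T`-invariant. -/
lemma bddAbove_birkhoffMax_map_iff (x : X) :
    BddAbove (Set.range fun n => birkhoffMax T f n (T x)) ↔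
      BddAbove (Set.range fun n => birkhoffMax T f n x) := by
  constructor
  · rintro ⟨B, hB⟩
    refine ⟨max 0 (f x + B), ?_⟩
    rintro _ ⟨n, rfl⟩
    refine (birkhoffMax_le_succ n x).trans (max_le_max le_rfl ?_)
    have := hB ⟨n, rfl⟩
    simp only at this
    linarith
  · rintro ⟨B, hB⟩
    refine ⟨B - f x, ?_⟩
    rintro _ ⟨n, rfl⟩
    have h1 : birkhoffMax T f (n + 1) x ≤ B := hB ⟨n + 1, rfl⟩
    have h2 : f x + birkhoffMax T f n (T x) ≤ birkhoffMax T f (n + 1) x := le_max_right _ _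
    simp only
    linarith

/-- The right side is dominated by `|f x|` and equals `f x` once the maxima exceed `-f x`; the left
side has nonnegative integral by invariance and monotonicity. -/
lemma birkhoffMax_succ_sub (n : ℕ) (x : X) :
    birkhoffMax T f (n + 1) x - birkhoffMax T f n (T x)
      = max (-birkhoffMax T f n (T x)) (f x) := by
  change max 0 (f x + birkhoffMax T f n (T x)) - _ = _
  rw [← max_sub_sub_right]
  simp

variable [MeasurableSpace X] {μ : Measure X}

lemma measurable_birkhoffMax (hT : Measurable T) (hf : Measurable f) (n : ℕ) :
    Measurable (birkhoffMax T f n) := by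
  induction n with
  | zero => exact measurable_const
  | succ n ih => exact measurable_const.max (hf.add (ih.comp hT))

lemma integrable_birkhoffMax (hT : MeasurePreserving T μ μ) [IsFiniteMeasure μ]
    (hfi : Integrable f μ) (n : ℕ) : Integrable (birkhoffMax T f n) μ := by
  induction n with
  | zero => exact integrable_const 0
  | succ n ih => exact (integrable_const 0).sup (hfi.add (hT.integrable_comp_of_integrable ih))

/-- If an integrable function has negative integral, then its Birkhoff sums along an ergodic map
are almost everywhere bounded above. -/
theorem Ergodic.ae_bddAbove_birkhoffSum [IsProbabilityMeasure μ] (hT : Ergodic T μ)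
    (hf : Measurable f) (hfi : Integrable f μ) (hneg : ∫ x, f x ∂μ < 0) :
    ∀ᵐ x ∂μ, BddAbove (Set.range fun n => birkhoffSum T f n x) := by
  have hmp := hT.toMeasurePreserving
  have hmeas : MeasurableSet {x | BddAbove (Set.range fun n => birkhoffMax T f n x)} :=
    measurableSet_bddAbove_range fun n => measurable_birkhoffMax hmp.measurable hf n
  have hinv : T ⁻¹' {x | BddAbove (Set.range fun n => birkhoffMax T f n x)}
      = {x | BddAbove (Set.range fun n => birkhoffMax T f n x)} := by
    ext x
    exact bddAbove_birkhoffMax_map_iff x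
  rcases hT.toPreErgodic.ae_mem_or_ae_notMem hmeas hinv with h | h
  · filter_upwards [h] with x hx
    obtain ⟨B, hB⟩ := hx
    refine ⟨B, ?_⟩
    rintro _ ⟨n, rfl⟩
    exact (birkhoffSum_le_birkhoffMax n x).trans (hB ⟨n, rfl⟩)
  -- If the maxima diverge a.e., dominated convergence of the increments gives 0 ≤ ∫ f, a
  -- contradiction.
  · exfalso
    have hlim : ∀ᵐ x ∂μ, Tendsto
        (fun n => birkhoffMax T f (n + 1) x - birkhoffMax T f n (T x)) atTop (𝓝 (f x)) := by
      filter_upwards [h] with x hx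
      have hx' : ¬ BddAbove (Set.range fun n => birkhoffMax T f n (T x)) := fun hb =>
        hx ((bddAbove_birkhoffMax_map_iff x).1 hb)
      have htop := tendsto_atTop_of_monotone (monotone_birkhoffMax (T := T) (f := f) (T x))
      rcases htop with htop | ⟨l, hl⟩
      · refine tendsto_const_nhds.congr' ?_
        filter_upwards [htop.eventually_ge_atTop (-f x)] with n hn
        rw [birkhoffMax_succ_sub, max_eq_right (by linarith)]
      · exact absurd hl.bddAbove_range hx'
    have hint := tendsto_integral_of_dominated_convergence (fun x => |f x|)
      (fun n => ((measurable_birkhoffMax hmp.measurable hf (n + 1)).sub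
        ((measurable_birkhoffMax hmp.measurable hf n).comp hmp.measurable)).aestronglyMeasurable)
      hfi.abs (fun n => Eventually.of_forall fun x => ?_) hlim
    · refine absurd (ge_of_tendsto' hint fun n => ?_) (not_le.2 hneg)
      have hi := integrable_birkhoffMax hmp hfi
      have h1 : ∫ x, birkhoffMax T f n (T x) ∂μ = ∫ x, birkhoffMax T f n x ∂μ := by
        conv_rhs => rw [← hmp.map_eq]
        rw [integral_map hmp.measurable.aemeasurable]
        rw [hmp.map_eq]
        exact (hi n).aestronglyMeasurable
      have hc : Integrable (fun x => birkhoffMax T f n (T x)) μ :=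
        hmp.integrable_comp_of_integrable (hi n)
      simp only [Pi.sub_apply, Function.comp_def]
      rw [integral_sub (hi (n + 1)) hc, h1, sub_nonneg]
      exact integral_mono (hi n) (hi (n + 1)) (birkhoffMax_le_succ n)
    · have h0 := birkhoffMax_nonneg (T := T) (f := f) n (T x)
      simp only [Pi.sub_apply, Function.comp_def]
      rw [birkhoffMax_succ_sub, Real.norm_eq_abs, abs_le]
      refine ⟨?_, max_le ?_ (le_abs_self _)⟩
      · exact (neg_abs_le _).trans (le_max_right _ _)
      · linarith [abs_nonneg (f x)]

/-- The upper half of Birkhoff's pointwise ergodic theorem. -/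
theorem Ergodic.ae_eventually_average_lt [IsProbabilityMeasure μ] (hT : Ergodic T μ)
    (hf : Measurable f) (hfi : Integrable f μ) {a : ℝ} (ha : ∫ x, f x ∂μ < a) :
    ∀ᵐ x ∂μ, ∀ᶠ n : ℕ in atTop, (1 / (n : ℝ)) * ∑ t ∈ Finset.Icc 1 n, f (T^[t] x) < a := by
  obtain ⟨b, hb, hba⟩ := exists_between ha
  have h := hT.ae_bddAbove_birkhoffSum (f := fun x => f x - b) (hf.sub_const b)
    (hfi.sub (integrable_const b)) (by
      rw [integral_sub hfi (integrable_const b)]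
      simpa using hb)
  -- The average runs over t = 1, …, n, so it is a Birkhoff sum started at `T x`; the null set is
  -- pulled back along `T`.
  filter_upwards [hT.toMeasurePreserving.quasiMeasurePreserving.ae h] with x hx
  obtain ⟨B, hB⟩ := hx
  have hlim : Tendsto (fun n : ℕ => B / (n : ℝ)) atTop (𝓝 0) :=
    tendsto_const_div_atTop_nhds_zero_nat B
  filter_upwards [hlim.eventually_lt_const (sub_pos.2 hba), eventually_gt_atTop 0] with n hn hpos
  have hn0 : (0 : ℝ) < n := by exact_mod_cast hpos
  have hs : birkhoffSum T (fun x => f x - b) n (T x) ≤ B := hB ⟨n, rfl⟩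
  have heq : birkhoffSum T (fun x => f x - b) n (T x)
      = (∑ t ∈ Finset.Icc 1 n, f (T^[t] x)) - n * b := by
    have : ∑ t ∈ Finset.Icc 1 n, f (T^[t] x) = ∑ t ∈ Finset.range n, f (T^[t] (T x)) := by
      rw [Finset.range_eq_Ico, Finset.sum_Ico_eq_sum_range, ← Finset.Ico_add_one_right_eq_Icc,
        Finset.sum_Ico_eq_sum_range]
      refine Finset.sum_congr (by simp) fun i _ => ?_
      rw [← Function.iterate_succ_apply]
      congr 2
      omega
    rw [this]
    simp [birkhoffSum, Finset.sum_sub_distrib]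
  rw [heq] at hs
  rw [div_lt_iff₀ hn0] at hn
  rw [one_div, inv_mul_lt_iff₀ hn0]
  nlinarith

end BirkhoffMax

/-! ### Ergodic averages along the observed process. -/

section ErgodicAverage

variable {Ω : Type*}

/-- The trajectory of `ε` seen from time `t`. -/
def pathFrom (ε : ℤ → Ω → ℝ) (t : ℤ) (ω : Ω) : ℤ → ℝ := fun u => ε (u + t) ω

lemma iterate_shift (x : ℤ → ℝ) (n : ℕ) :
    (fun (x : ℤ → ℝ) (t : ℤ) => x (t + 1))^[n] x = fun u => x (u + n) := by
  induction n with
  | zero => simp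
  | succ n ih =>
    rw [Function.iterate_succ_apply', ih]
    funext u
    push_cast
    congr 1
    ring

variable [MeasurableSpace Ω] {P : Measure Ω} [IsProbabilityMeasure P] {ε : ℤ → Ω → ℝ}

lemma measurable_pathFrom (hε : ∀ t, Measurable (ε t)) (t : ℤ) : Measurable (pathFrom ε t) :=
  measurable_pi_lambda _ fun u => hε (u + t)

theorem StationaryErgodic.ae_eventually_average_lt (h : StationaryErgodic P ε)
    (hε : ∀ t, Measurable (ε t)) {g : (ℤ → ℝ) → ℝ} (hg : Measurable g)
    (hgi : Integrable (fun ω => g (pathFrom ε 0 ω)) P) {a : ℝ}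
    (ha : ∫ ω, g (pathFrom ε 0 ω) ∂P < a) :
    ∀ᵐ ω ∂P, ∀ᶠ n : ℕ in atTop,
      (1 / (n : ℝ)) * ∑ t ∈ Finset.Icc 1 n, g (pathFrom ε t ω) < a := by
  have hm : Measurable fun ω t => ε t ω := measurable_pi_lambda _ hε
  have h0 : pathFrom ε 0 = fun ω t => ε t ω := by
    funext ω u
    simp [pathFrom]
  rw [h0] at hgi ha
  have : IsProbabilityMeasure (P.map fun ω t => ε t ω) :=
    Measure.isProbabilityMeasure_map hm.aemeasurable
  have key := Ergodic.ae_eventually_average_lt (T := fun (x : ℤ → ℝ) (t : ℤ) => x (t + 1)) h hg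
    ((integrable_map_measure hg.aestronglyMeasurable hm.aemeasurable).2 hgi) (a := a)
    (by rwa [integral_map hm.aemeasurable hg.aestronglyMeasurable])
  filter_upwards [ae_of_ae_map hm.aemeasurable key] with ω hω
  filter_upwards [hω] with n hn
  simp only [iterate_shift] at hn
  exact hn

theorem StationaryErgodic.ae_eventually_lt_average (h : StationaryErgodic P ε)
    (hε : ∀ t, Measurable (ε t)) {g : (ℤ → ℝ) → ℝ} (hg : Measurable g)
    (hgi : Integrable (fun ω => g (pathFrom ε 0 ω)) P) {a : ℝ}
    (ha : a < ∫ ω, g (pathFrom ε 0 ω) ∂P) :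
    ∀ᵐ ω ∂P, ∀ᶠ n : ℕ in atTop,
      a < (1 / (n : ℝ)) * ∑ t ∈ Finset.Icc 1 n, g (pathFrom ε t ω) := by
  have := h.ae_eventually_average_lt hε hg.neg hgi.neg (a := -a)
    (by simpa [integral_neg] using ha)
  filter_upwards [this] with ω hω
  filter_upwards [hω] with n hn
  simp only [Pi.neg_apply, Finset.sum_neg_distrib, mul_neg] at hn
  linarith

end ErgodicAverage

/-! ### Measurable local suprema. -/

section LocalSup

variable {X K : Type*} [MetricSpace K] [CompactSpace K] [Nonempty K]

/-- The supremum of `g x` over the ball of radius `δ` around `θ`, taken along a dense sequence. -/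
noncomputable def localSup (g : X → K → ℝ) (θ : K) (δ : ℝ) (x : X) : ℝ :=
  ⨆ i : {i : ℕ // TopologicalSpace.denseSeq K i ∈ Metric.ball θ δ},
    g x (TopologicalSpace.denseSeq K i)

variable {g : X → K → ℝ}

lemma measurable_localSup [MeasurableSpace X] (hg : ∀ θ, Measurable fun x => g x θ) (θ : K)
    (δ : ℝ) : Measurable (localSup g θ δ) :=
  Measurable.iSup fun _ => hg _

/-- A value above the countable supremum would persist on an open subset of the ball, which the
dense sequence meets. Compactness bounds the family, so that `⨆` is a genuine supremum. -/
lemma le_localSup {x : X} (hg : Continuous (g x)) {θ θ' : K} {δ : ℝ}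
    (h : θ' ∈ Metric.ball θ δ) : g x θ' ≤ localSup g θ δ x := by
  have hb : BddAbove (Set.range fun i : {i : ℕ // TopologicalSpace.denseSeq K i ∈
      Metric.ball θ δ} => g x (TopologicalSpace.denseSeq K i)) := by
    refine (isCompact_range hg).bddAbove.mono ?_
    rintro _ ⟨i, rfl⟩
    exact ⟨_, rfl⟩
  by_contra! hlt
  obtain ⟨_, ⟨h1, h2⟩, i, rfl⟩ := (TopologicalSpace.denseRange_denseSeq K).exists_mem_open
    (Metric.isOpen_ball.inter (isOpen_lt continuous_const hg)) ⟨θ', h, hlt⟩ |>.imp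
      fun i hi => (⟨hi, i, rfl⟩ : _ ∧ ∃ j, j = i)
  exact absurd (le_ciSup hb ⟨_, h1⟩) (not_le.2 h2)

lemma localSup_le {x : X} {θ : K} {δ b : ℝ} (hδ : 0 < δ)
    (h : ∀ θ' ∈ Metric.ball θ δ, g x θ' ≤ b) : localSup g θ δ x ≤ b := by
  obtain ⟨i, hi⟩ := (TopologicalSpace.denseRange_denseSeq K).exists_mem_open
    (Metric.isOpen_ball (x := θ) (ε := δ)) ⟨θ, Metric.mem_ball_self hδ⟩
  -- Over an empty index the real supremum would be the default value 0.
  have : Nonempty {i : ℕ // TopologicalSpace.denseSeq K i ∈ Metric.ball θ δ} := ⟨⟨i, hi⟩⟩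
  exact ciSup_le fun j => h _ j.2

lemma tendsto_localSup {x : X} (hg : Continuous (g x)) (θ : K) :
    Tendsto (fun k : ℕ => localSup g θ (1 / ((k : ℝ) + 1)) x) atTop (𝓝 (g x θ)) := by
  rw [tendsto_order]
  refine ⟨fun a ha => Eventually.of_forall fun k => ha.trans_le
    (le_localSup hg (Metric.mem_ball_self (by positivity))), fun a ha => ?_⟩
  obtain ⟨b, hb, hba⟩ := exists_between ha
  obtain ⟨δ, hδ, hball⟩ := Metric.eventually_nhds_iff_ball.1
    ((hg.tendsto θ).eventually_lt_const hb)
  filter_upwards [tendsto_one_div_add_atTop_nhds_zero_nat.eventually_lt_const hδ] with k hk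
  refine (localSup_le (by positivity) fun θ' hθ' => ?_).trans_lt hba
  exact (hball θ' (Metric.ball_subset_ball hk.le hθ')).le

end LocalSup

/-! ### From pointwise to uniform convergence of distribution functions. -/

section Polya

/-- Pólya's theorem: monotone functions with values in `[0, 1]` that converge at every rational
point to a continuous distribution function converge uniformly. -/
theorem eventually_forall_abs_sub_le_of_tendsto_rat {G : ℕ → ℝ → ℝ} {F : ℝ → ℝ}
    (hG : ∀ n, Monotone (G n)) (hG0 : ∀ n x, 0 ≤ G n x) (hG1 : ∀ n x, G n x ≤ 1)
    (hF : Monotone F) (hFc : Continuous F) (hF0 : Tendsto F atBot (𝓝 0))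
    (hF1 : Tendsto F atTop (𝓝 1)) (h : ∀ q : ℚ, Tendsto (fun n => G n q) atTop (𝓝 (F q)))
    {δ : ℝ} (hδ : 0 < δ) : ∀ᶠ n in atTop, ∀ x, |G n x - F x| ≤ δ := by
  have hF0' : ∀ x, 0 ≤ F x := fun x => hF.le_of_tendsto hF0 x
  have hF1' : ∀ x, F x ≤ 1 := fun x => hF.ge_of_tendsto hF1 x
  have hδ2 : 0 < δ / 2 := half_pos hδ
  have hlt : ∀ q : ℚ, ∀ᶠ n in atTop, |G n q - F q| < δ / 2 := fun q => by
    have := (h q).sub_const (F q)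
    rw [sub_self] at this
    simpa using this.abs.eventually_lt_const (u := δ / 2) (by simpa using hδ2)
  obtain ⟨a, ha⟩ := (hF0.eventually_lt_const hδ2).exists_forall_of_atBot
  obtain ⟨b, hb⟩ := (hF1.eventually_const_lt
    (show 1 - δ / 2 < 1 by linarith)).exists_forall_of_atTop
  obtain ⟨p, hp⟩ := exists_rat_lt a
  obtain ⟨q, hq⟩ := exists_rat_gt b
  -- Each point is enclosed by rationals between which `F` varies by less than δ/2; monotonicity
  -- transports the δ/2 error at the endpoints inwards, and compactness leaves finitely many such
  -- intervals.
  have hmid : ∀ᶠ n in atTop, ∀ x ∈ Set.Icc (p : ℝ) q, |G n x - F x| ≤ δ := by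
    refine (isCompact_Icc (a := (p : ℝ)) (b := q)).induction_on
      (p := fun S => ∀ᶠ n in atTop, ∀ x ∈ S, |G n x - F x| ≤ δ) ?_ ?_ ?_ ?_
    · simp
    · intro S S' hSS' hS'
      filter_upwards [hS'] with n hn x hx using hn x (hSS' hx)
    · intro S S' hS hS'
      filter_upwards [hS, hS'] with n hn hn' x hx
      exact hx.elim (hn x) (hn' x)
    · intro x _
      obtain ⟨κ, hκ, hball⟩ := Metric.continuousAt_iff.1 (hFc.continuousAt (x := x)) (δ / 4)
        (by linarith)
      obtain ⟨u, hu1, hu2⟩ := exists_rat_btwn (show x - κ < x by linarith)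
      obtain ⟨v, hv1, hv2⟩ := exists_rat_btwn (show x < x + κ by linarith)
      have hFu : |F u - F x| < δ / 4 := hball (by rw [Real.dist_eq, abs_lt]; constructor <;> linarith)
      have hFv : |F v - F x| < δ / 4 := hball (by rw [Real.dist_eq, abs_lt]; constructor <;> linarith)
      refine ⟨Set.Ioo u v, mem_nhdsWithin_of_mem_nhds (Ioo_mem_nhds hu2 hv1), ?_⟩
      filter_upwards [hlt u, hlt v] with n hnu hnv y hy
      have h1 := hG n hy.1.le
      have h2 := hG n hy.2.le
      have h3 := hF hy.1.le
      have h4 := hF hy.2.le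
      rw [abs_lt] at hFu hFv hnu hnv
      rw [abs_le]
      constructor <;> linarith
  filter_upwards [hmid, hlt p, hlt q] with n hn hnp hnq x
  rcases lt_or_ge x p with hxp | hxp
  · have h1 := hG n hxp.le
    have h2 := ha p hp.le
    have h3 := hF hxp.le
    have h4 := hF0' x
    have h5 := hG0 n x
    rw [abs_lt] at hnp
    rw [abs_le]
    constructor <;> linarith
  rcases le_or_gt x q with hxq | hxq
  · exact hn x ⟨hxp, hxq⟩
  · have h1 := hG n hxq.le
    have h2 := hb q hq.le
    have h3 := hF hxq.le
    have h4 := hF1' x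
    have h5 := hG1 n x
    rw [abs_lt] at hnq
    rw [abs_le]
    constructor <;> linarith

end Polya

/-! ### Quantiles and the check loss. -/

section Quantile

/-- `z` is an `α`-quantile of `G`. -/
def IsQuantileOf (G : ℝ → ℝ) (α z : ℝ) : Prop :=
  (∀ y < z, G y ≤ α) ∧ ∀ y, z < y → α ≤ G y

/-- The limit 0 at -∞ bounds the superlevel set below, which is what makes `sInf` meaningful. -/
lemma lt_of_lt_genInv {F : ℝ → ℝ} {α : ℝ} (hF0 : Tendsto F atBot (𝓝 0)) (hα : 0 < α) {x : ℝ}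
    (hx : x < genInv F α) : F x < α := by
  by_contra! h
  refine absurd hx (not_lt.2 (csInf_le ?_ h))
  obtain ⟨a, ha⟩ := (hF0.eventually_lt_const hα).exists_forall_of_atBot
  refine ⟨a, fun y hy => ?_⟩
  by_contra! hya
  exact absurd (ha y hya.le) (not_lt.2 hy)

theorem tendsto_quantile {G : ℕ → ℝ → ℝ} {F : ℝ → ℝ} {α ξ : ℝ} {z : ℕ → ℝ}
    (h : ∀ x, Tendsto (fun n => G n x) atTop (𝓝 (F x))) (hlow : ∀ x < ξ, F x < α)
    (hup : ∀ x, ξ < x → α < F x) (hz : ∀ᶠ n in atTop, IsQuantileOf (G n) α (z n)) :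
    Tendsto z atTop (𝓝 ξ) := by
  rw [tendsto_order]
  refine ⟨fun a ha => ?_, fun a ha => ?_⟩
  · obtain ⟨b, hab, hb⟩ := exists_between ha
    filter_upwards [hz, (h b).eventually_lt_const (hlow b hb)] with n hn hlt
    by_contra! hle
    exact absurd (hn.2 b (hle.trans_lt hab)) (not_le.2 hlt)
  · obtain ⟨b, hb, hba⟩ := exists_between ha
    filter_upwards [hz, (h b).eventually_const_lt (hup b hb)] with n hn hlt
    by_contra! hle
    exact absurd (hn.1 b (hba.trans_le hle)) (not_le.2 hlt)

/-- The points `x` and `y` exclude the default value of `sInf`: one bounds the superlevel set below,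
the other shows that it is nonempty. -/
lemma isQuantileOf_genInv {G : ℝ → ℝ} (hG : Monotone G) {α x y : ℝ} (hx : G x < α)
    (hy : α < G y) : IsQuantileOf G α (genInv G α) := by
  have hb : BddBelow {τ | α ≤ G τ} := by
    refine ⟨x, fun τ hτ => ?_⟩
    by_contra! h
    exact absurd ((hG h.le).trans_lt hx) (not_lt.2 hτ)
  refine ⟨fun u hu => ?_, fun u hu => ?_⟩
  · by_contra! h
    exact absurd hu (not_lt.2 (csInf_le hb h.le))
  · obtain ⟨τ, hτ, hτu⟩ := exists_lt_of_csInf_lt ⟨y, hy.le⟩ hu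
    exact (show α ≤ G τ from hτ).trans (hG hτu.le)

/-- Subgradient inequality: z ↦ ρ_α(e - z) is convex with right derivative 1{e ≤ y} - α at y. The
next lemma uses the same subgradient on the other side. -/
lemma le_checkLoss_sub_of_lt (α e : ℝ) {y z : ℝ} (h : y < z) :
    (z - y) * (Set.indicator (Set.Iic y) (fun _ => (1 : ℝ)) e - α)
      ≤ checkLoss α (e - z) - checkLoss α (e - y) := by
  unfold checkLoss
  simp only [Set.indicator_apply, Set.mem_Iic, Set.mem_Iio]
  split_ifs <;> nlinarith

lemma checkLoss_sub_le_of_lt (α e : ℝ) {y z : ℝ} (h : z < y) :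
    checkLoss α (e - y) - checkLoss α (e - z)
      ≤ (y - z) * (Set.indicator (Set.Iic y) (fun _ => (1 : ℝ)) e - α) := by
  unfold checkLoss
  simp only [Set.indicator_apply, Set.mem_Iic, Set.mem_Iio]
  split_ifs <;> nlinarith

/-- A minimizer of the empirical check loss is a quantile of the empirical distribution. -/
theorem isQuantileOf_of_isMinOn_checkLoss {n : ℕ} (hn : 1 ≤ n) (e : ℕ → ℝ) {α z : ℝ}
    (hz : IsMinOn (fun z : ℝ => (1 / (n : ℝ)) * ∑ t ∈ Finset.Icc 1 n, checkLoss α (e t - z))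
      Set.univ z) :
    IsQuantileOf (fun x => (1 / (n : ℝ)) * ∑ t ∈ Finset.Icc 1 n,
      Set.indicator (Set.Iic x) (fun _ => (1 : ℝ)) (e t)) α z := by
  have hn0 : (0 : ℝ) < n := by exact_mod_cast hn
  have hmin : ∀ y, ∑ t ∈ Finset.Icc 1 n, checkLoss α (e t - z)
      ≤ ∑ t ∈ Finset.Icc 1 n, checkLoss α (e t - y) := fun y =>
    le_of_mul_le_mul_left (isMinOn_iff.1 hz y (Set.mem_univ _)) (by positivity)
  have hsum : ∀ c x : ℝ, ∑ t ∈ Finset.Icc 1 n,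
      c * (Set.indicator (Set.Iic x) (fun _ => (1 : ℝ)) (e t) - α)
      = c * (∑ t ∈ Finset.Icc 1 n, Set.indicator (Set.Iic x) (fun _ => (1 : ℝ)) (e t) - n * α) := by
    intro c x
    rw [← Finset.mul_sum, Finset.sum_sub_distrib]
    simp
  refine ⟨fun y hy => ?_, fun y hy => ?_⟩
  · have h1 := Finset.sum_le_sum fun t (_ : t ∈ Finset.Icc 1 n) =>
      le_checkLoss_sub_of_lt α (e t) hy
    rw [hsum, Finset.sum_sub_distrib] at h1
    have h2 := hmin y
    rw [one_div, inv_mul_le_iff₀ hn0]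
    have h3 := sub_pos.2 hy
    by_contra! hlt
    have := mul_pos h3 (sub_pos.2 hlt)
    linarith
  · have h1 := Finset.sum_le_sum fun t (_ : t ∈ Finset.Icc 1 n) =>
      checkLoss_sub_le_of_lt α (e t) hy
    rw [hsum, Finset.sum_sub_distrib] at h1
    have h2 := hmin y
    rw [one_div, le_inv_mul_iff₀ hn0]
    have h3 := sub_pos.2 hy
    by_contra! hlt
    have := mul_pos h3 (sub_pos.2 hlt)
    linarith

end Quantile

/-! ### Gaussian log-likelihood and the effect of presample values. -/

section GaussLogLik

/-- The Gaussian log-density (up to a constant) of an observation `e` with standard deviation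
`w`. -/
noncomputable def gaussLogLik (e w : ℝ) : ℝ := -(1 / 2 : ℝ) * (e / w) ^ 2 - Real.log w

/-- The derivative in w is e²/w³ - 1/w, which explains the Lipschitz constant on [c, ∞). -/
lemma gaussLogLik_sub_le {c w w' : ℝ} (e : ℝ) (hc : 0 < c) (hw : c ≤ w) (hw' : c ≤ w') :
    gaussLogLik e w - gaussLogLik e w' ≤ (e ^ 2 / c ^ 3 + 1 / c) * |w - w'| := by
  have hw0 : 0 < w := hc.trans_le hw
  have hw0' : 0 < w' := hc.trans_le hw'
  have hlog : Real.log w' - Real.log w ≤ 1 / c * |w - w'| := by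
    rw [← Real.log_div hw0'.ne' hw0.ne']
    refine (Real.log_le_sub_one_of_pos (by positivity)).trans ?_
    have : w' / w - 1 = (1 / w) * (w' - w) := by field_simp
    rw [this]
    calc (1 / w) * (w' - w) ≤ (1 / w) * |w - w'| := by
          rw [abs_sub_comm]
          exact mul_le_mul_of_nonneg_left (le_abs_self _) (by positivity)
      _ ≤ 1 / c * |w - w'| := by gcongr
  have hsq : (e / w') ^ 2 - (e / w) ^ 2 ≤ 2 * (e ^ 2 / c ^ 3 * |w - w'|) := by
    have h1 : (e / w') ^ 2 - (e / w) ^ 2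
        = e ^ 2 * (1 / (w * w' ^ 2) + 1 / (w ^ 2 * w')) * (w - w') := by
      field_simp
      ring
    have h2 : 1 / (w * w' ^ 2) ≤ 1 / c ^ 3 := by
      have : c ^ 3 ≤ w * w' ^ 2 := by
        calc c ^ 3 = c * c ^ 2 := by ring
          _ ≤ w * w' ^ 2 := by gcongr
      gcongr
    have h3 : 1 / (w ^ 2 * w') ≤ 1 / c ^ 3 := by
      have : c ^ 3 ≤ w ^ 2 * w' := by
        calc c ^ 3 = c ^ 2 * c := by ring
          _ ≤ w ^ 2 * w' := by gcongr
      gcongr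
    rw [h1]
    calc e ^ 2 * (1 / (w * w' ^ 2) + 1 / (w ^ 2 * w')) * (w - w')
        ≤ e ^ 2 * (1 / (w * w' ^ 2) + 1 / (w ^ 2 * w')) * |w - w'| :=
          mul_le_mul_of_nonneg_left (le_abs_self _) (by positivity)
      _ ≤ e ^ 2 * (1 / c ^ 3 + 1 / c ^ 3) * |w - w'| := by gcongr
      _ = _ := by ring
  unfold gaussLogLik
  linarith

lemma abs_gaussLogLik_sub_le {c w w' : ℝ} (e : ℝ) (hc : 0 < c) (hw : c ≤ w) (hw' : c ≤ w') :
    |gaussLogLik e w - gaussLogLik e w'| ≤ (e ^ 2 / c ^ 3 + 1 / c) * |w - w'| := by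
  rw [abs_le]
  have h1 := gaussLogLik_sub_le e hc hw hw'
  have h2 := gaussLogLik_sub_le e hc hw' hw
  rw [abs_sub_comm] at h2
  constructor <;> linarith

lemma gaussLogLik_le {c w : ℝ} (e : ℝ) (hc : 0 < c) (hw : c ≤ w) :
    gaussLogLik e w ≤ -Real.log c := by
  have := Real.log_le_log hc hw
  have := sq_nonneg (e / w)
  unfold gaussLogLik
  linarith

lemma continuous_gaussLogLik {K : Type*} [TopologicalSpace K] {w : K → ℝ} (hw : Continuous w)
    (hw0 : ∀ θ, 0 < w θ) (e : ℝ) : Continuous fun θ => gaussLogLik e (w θ) :=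
  (continuous_const.mul ((continuous_const.div hw fun θ => (hw0 θ).ne').pow 2)).sub
    (hw.log fun θ => (hw0 θ).ne')

lemma tendsto_average_Icc {D : ℕ → ℝ} (hD : Tendsto D atTop (𝓝 0)) :
    Tendsto (fun n : ℕ => (1 / (n : ℝ)) * ∑ t ∈ Finset.Icc 1 n, D t) atTop (𝓝 0) := by
  have h := ((tendsto_add_atTop_iff_nat 1).2 hD).cesaro
  refine h.congr fun n => ?_
  rw [one_div, ← Finset.Ico_add_one_right_eq_Icc, Finset.sum_Ico_eq_sum_range]
  simp [add_comm]

/-- If the volatilities `w t` and `w' t` are exponentially close and the observations grow at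
most polynomially, then the log-likelihoods are uniformly close. -/
lemma exists_tendsto_zero_abs_gaussLogLik_sub_le {K : Type*} [TopologicalSpace K]
    [CompactSpace K] [Nonempty K] {w w' : ℕ → K → ℝ} {e : ℕ → ℝ} {c C ρ A : ℝ} {k : ℕ}
    (hw : ∀ t, Continuous (w t)) (hw' : ∀ t, Continuous (w' t)) (hw0 : ∀ t θ, 0 < w t θ)
    (hw0' : ∀ t θ, 0 < w' t θ) (hc : 0 < c)
    (hcw : ∀ t θ, c < w t θ) (hρ0 : 0 < ρ) (hρ1 : ρ < 1)
    (hclose : ∀ t, 1 ≤ t → ∀ θ, |w t θ - w' t θ| ≤ C * ρ ^ t)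
    (he : ∀ᶠ t : ℕ in atTop, e t ^ 2 ≤ A * (t : ℝ) ^ k) :
    ∃ D : ℕ → ℝ, Tendsto D atTop (𝓝 0) ∧
      ∀ t θ, |gaussLogLik (e t) (w t θ) - gaussLogLik (e t) (w' t θ)| ≤ D t := by
  refine ⟨fun t => ⨆ θ, |gaussLogLik (e t) (w t θ) - gaussLogLik (e t) (w' t θ)|, ?_, ?_⟩
  · have hpow : ∀ j : ℕ, Tendsto (fun t : ℕ => (t : ℝ) ^ j * ρ ^ t) atTop (𝓝 0) := fun j =>
      tendsto_pow_const_mul_const_pow_of_abs_lt_one j (by rwa [abs_of_pos hρ0])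
    -- The lower bound `c` is known for `w` only; `w'` eventually exceeds `c / 2`, hence the
    -- Lipschitz constant at `c / 2`.
    have hbound : Tendsto (fun t : ℕ => (A / (c / 2) ^ 3 * C) * ((t : ℝ) ^ k * ρ ^ t)
        + (1 / (c / 2) * C) * ((t : ℝ) ^ 0 * ρ ^ t)) atTop (𝓝 0) := by
      simpa using ((hpow k).const_mul (A / (c / 2) ^ 3 * C)).add
        ((hpow 0).const_mul (1 / (c / 2) * C))
    have hsmall : Tendsto (fun t : ℕ => C * ((t : ℝ) ^ 0 * ρ ^ t)) atTop (𝓝 0) := by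
      simpa using (hpow 0).const_mul C
    refine tendsto_of_tendsto_of_tendsto_of_le_of_le' tendsto_const_nhds hbound
      (Eventually.of_forall fun t => Real.iSup_nonneg fun θ => abs_nonneg _) ?_
    filter_upwards [he, hsmall.eventually_lt_const (half_pos hc), eventually_ge_atTop 1]
      with t het hst ht1
    refine ciSup_le fun θ => ?_
    have h1 := hclose t ht1 θ
    rw [pow_zero, one_mul] at hst
    have h2 : c / 2 ≤ w t θ := by linarith [hcw t θ]
    have h3 : c / 2 ≤ w' t θ := by
      have := (abs_le.1 h1).2
      linarith [hcw t θ]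
    refine (abs_gaussLogLik_sub_le (e t) (half_pos hc) h2 h3).trans ?_
    have hA : 0 ≤ A * (t : ℝ) ^ k := (sq_nonneg _).trans het
    calc (e t ^ 2 / (c / 2) ^ 3 + 1 / (c / 2)) * |w t θ - w' t θ|
        ≤ (A * (t : ℝ) ^ k / (c / 2) ^ 3 + 1 / (c / 2)) * (C * ρ ^ t) := by gcongr
      _ = _ := by ring
  · intro t θ
    refine le_ciSup (f := fun θ => |gaussLogLik (e t) (w t θ) - gaussLogLik (e t) (w' t θ)|) ?_ θ
    exact (isCompact_range ((continuous_gaussLogLik (hw t) (hw0 t) (e t)).sub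
      (continuous_gaussLogLik (hw' t) (hw0' t) (e t))).abs).bddAbove

end GaussLogLik

/-! ### Truncated envelopes of the likelihood. -/

section Envelope

variable {X K : Type*} [MeasurableSpace X] {μ : Measure X} [IsProbabilityMeasure μ]

/-- The conditional `hL` covers the case where the integral is -∞, for which the Bochner integral is
0. If all truncated integrals were at least `L`, Fatou would make `f` integrable and dominated
convergence would contradict `hL`. -/
lemma exists_integral_max_neg_lt {f : X → ℝ} (hf : Measurable f) {b L : ℝ}
    (hb : ∀ᵐ x ∂μ, f x ≤ b) (hL : Integrable f μ → ∫ x, f x ∂μ < L) :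
    ∃ M : ℕ, ∫ x, max (f x) (-(M : ℝ)) ∂μ < L := by
  by_contra! hcon
  have hmeas : ∀ M : ℕ, Measurable fun x => max (f x) (-(M : ℝ)) := fun M => hf.max measurable_const
  have hint : ∀ M : ℕ, Integrable (fun x => max (f x) (-(M : ℝ))) μ := fun M => by
    refine Integrable.of_bound (hmeas M).aestronglyMeasurable (max |b| M) ?_
    filter_upwards [hb] with x hx
    rw [Real.norm_eq_abs, abs_le]
    refine ⟨?_, max_le ((hx.trans (le_abs_self b)).trans (le_max_left _ _)) ?_⟩
    · exact (neg_le_neg (le_max_right _ _)).trans (le_max_right _ _)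
    · exact (neg_nonpos.2 (Nat.cast_nonneg M)).trans ((abs_nonneg b).trans (le_max_left _ _))
  have hlim : ∀ x, Tendsto (fun M : ℕ => max (f x) (-(M : ℝ))) atTop (𝓝 (f x)) := fun x => by
    refine tendsto_const_nhds.congr' ?_
    filter_upwards [eventually_ge_atTop ⌈-f x⌉₊] with M hM
    have : -f x ≤ M := (Nat.le_ceil _).trans (by exact_mod_cast hM)
    rw [max_eq_left (by linarith)]
  have hnn : ∀ M : ℕ, ∀ᵐ x ∂μ, 0 ≤ max b 0 - max (f x) (-(M : ℝ)) := fun M => by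
    filter_upwards [hb] with x hx
    have : -(M : ℝ) ≤ 0 := neg_nonpos.2 (Nat.cast_nonneg M)
    linarith [max_le_max hx this]
  have hfi : Integrable (fun x => max b 0 - f x) μ := by
    have hfatou : ∫⁻ x, ‖max b 0 - f x‖ₑ ∂μ
        ≤ liminf (fun M : ℕ => ∫⁻ x, ‖max b 0 - max (f x) (-(M : ℝ))‖ₑ ∂μ) atTop := by
      refine le_trans (le_of_eq (lintegral_congr fun x => ?_))
        (lintegral_liminf_le fun M => (measurable_const.sub (hmeas M)).enorm)
      exact ((hlim x).const_sub (max b 0)).enorm.liminf_eq.symm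
    refine ⟨(measurable_const.sub hf).aestronglyMeasurable, hfatou.trans_lt (Ne.lt_top ?_)⟩
    refine ne_top_of_le_ne_top (ENNReal.ofReal_ne_top (r := max b 0 - L)) ?_
    refine liminf_le_of_frequently_le' (Eventually.frequently (Eventually.of_forall fun M => ?_))
    have hi : Integrable (fun x => max b 0 - max (f x) (-(M : ℝ))) μ :=
      (integrable_const _).sub (hint M)
    rw [← ofReal_integral_norm_eq_lintegral_enorm hi]
    refine ENNReal.ofReal_le_ofReal ?_
    have : ∫ x, ‖max b 0 - max (f x) (-(M : ℝ))‖ ∂μ = ∫ x, (max b 0 - max (f x) (-(M : ℝ))) ∂μ :=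
      integral_congr_ae ((hnn M).mono fun x hx => Real.norm_of_nonneg hx)
    rw [this, integral_sub (integrable_const _) (hint M)]
    rw [integral_const, probReal_univ, one_smul]
    exact sub_le_sub_left (hcon M) _
  have hfi' : Integrable f μ := by
    have := (integrable_const (max b 0)).sub hfi
    refine this.congr (Eventually.of_forall fun x => ?_)
    simp
  have hconv := tendsto_integral_of_dominated_convergence (fun x => |f x|)
    (fun M => (hmeas M).aestronglyMeasurable) hfi'.abs
    (fun M => Eventually.of_forall fun x => by
      have : -(M : ℝ) ≤ 0 := neg_nonpos.2 (Nat.cast_nonneg M)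
      rw [Real.norm_eq_abs, abs_le]
      exact ⟨(neg_abs_le _).trans (le_max_left _ _),
        max_le (le_abs_self _) (this.trans (abs_nonneg _))⟩)
    (Eventually.of_forall hlim)
  exact absurd (ge_of_tendsto' hconv hcon) (not_le.2 (hL hfi'))

/-- Once the truncation level is fixed, the envelopes are bounded, so the ball can be shrunk under
the integral. -/
lemma exists_integral_max_localSup_lt [MetricSpace K] [CompactSpace K] [Nonempty K]
    {g : X → K → ℝ} (hg : ∀ θ, Measurable fun x => g x θ) (hgc : ∀ x, Continuous (g x))
    {b L : ℝ} (hb : ∀ᵐ x ∂μ, ∀ θ, g x θ ≤ b) (θ : K)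
    (hL : Integrable (fun x => g x θ) μ → ∫ x, g x θ ∂μ < L) :
    ∃ δ > 0, ∃ M : ℝ, Integrable (fun x => max (localSup g θ δ x) (-M)) μ ∧
      ∫ x, max (localSup g θ δ x) (-M) ∂μ < L := by
  obtain ⟨M, hM⟩ := exists_integral_max_neg_lt (hg θ) (hb.mono fun x hx => hx θ) hL
  have hbd : ∀ δ > 0, ∀ᵐ x ∂μ, ‖max (localSup g θ δ x) (-(M : ℝ))‖ ≤ max |b| M := by
    intro δ hδ
    filter_upwards [hb] with x hx
    rw [Real.norm_eq_abs, abs_le]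
    refine ⟨(neg_le_neg (le_max_right _ _)).trans (le_max_right _ _), max_le ?_ ?_⟩
    · exact (localSup_le hδ fun θ' _ => (hx θ').trans (le_abs_self b)).trans (le_max_left _ _)
    · exact (neg_nonpos.2 (Nat.cast_nonneg M)).trans ((abs_nonneg b).trans (le_max_left _ _))
  have hmeas : ∀ δ, AEStronglyMeasurable (fun x => max (localSup g θ δ x) (-(M : ℝ))) μ :=
    fun δ => ((measurable_localSup hg θ δ).max measurable_const).aestronglyMeasurable
  have hconv := tendsto_integral_of_dominated_convergence (μ := μ)
    (F := fun (k : ℕ) x => max (localSup g θ (1 / ((k : ℝ) + 1)) x) (-(M : ℝ)))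
    (f := fun x => max (g x θ) (-(M : ℝ))) (fun _ => max |b| M)
    (fun k => hmeas _) (integrable_const _) (fun k => hbd _ (by positivity))
    (Eventually.of_forall fun x => (tendsto_localSup (hgc x) θ).max tendsto_const_nhds)
  obtain ⟨k, hk⟩ := (hconv.eventually_lt_const hM).exists
  exact ⟨_, by positivity, M, Integrable.of_bound (hmeas _) _ (hbd _ (by positivity)), hk⟩

end Envelope

/-! ### Measurability of the volatility and growth of the observations. -/

section Growth

variable {Ω : Type*} {r : ℕ}

/-- The volatility at time `0` as a function of the trajectory. -/
def volAt (σ : (ℕ → ℝ) → EuclideanSpace ℝ (Fin r) → ℝ) (x : ℤ → ℝ)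
    (θ : EuclideanSpace ℝ (Fin r)) : ℝ :=
  σ (fun i : ℕ => x (-1 - i)) θ

variable {σ : (ℕ → ℝ) → EuclideanSpace ℝ (Fin r) → ℝ} {ε : ℤ → Ω → ℝ}

lemma volAt_pathFrom (t : ℤ) (θ : EuclideanSpace ℝ (Fin r)) (ω : Ω) :
    volAt σ (pathFrom ε t ω) θ = vol σ ε t θ ω := by
  unfold volAt vol pathFrom
  congr 1
  funext i
  congr 1
  ring

lemma pathFrom_zero (t : ℤ) (ω : Ω) : pathFrom ε t ω 0 = ε t ω := by
  simp [pathFrom]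

lemma measurable_volAt {θ : EuclideanSpace ℝ (Fin r)} (h : Measurable fun x => σ x θ) :
    Measurable fun x => volAt σ x θ :=
  h.comp (measurable_pi_lambda _ fun _ => measurable_pi_apply _)

lemma measurable_vol_pastSigma {θ : EuclideanSpace ℝ (Fin r)} (h : Measurable fun x => σ x θ)
    (t : ℤ) : Measurable[pastSigma ε (t - 1)] (vol σ ε t θ) := by
  refine h.comp (@measurable_pi_lambda Ω ℕ (fun _ => ℝ) (pastSigma ε (t - 1)) _ _ fun i => ?_)
  refine Measurable.mono (comap_measurable (ε (t - 1 - i))) ?_ le_rfl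
  exact le_iSup₂_of_le (f := fun u (_ : u ∈ Set.Iic (t - 1)) =>
    MeasurableSpace.comap (ε u) inferInstance) (t - 1 - i)
    (by simp only [Set.mem_Iic]; omega) le_rfl

variable [MeasurableSpace Ω] {P : Measure Ω} [IsProbabilityMeasure P]

lemma measurable_vol (hε : ∀ t, Measurable (ε t)) {θ : EuclideanSpace ℝ (Fin r)}
    (h : Measurable fun x => σ x θ) (t : ℤ) : Measurable (vol σ ε t θ) :=
  h.comp (measurable_pi_lambda _ fun _ => hε _)

/-- A nonnegative term is at most the whole sum, which grows at most linearly by the ergodic bound.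
-/
lemma StationaryErgodic.ae_exists_eventually_le_mul (h : StationaryErgodic P ε)
    (hε : ∀ t, Measurable (ε t)) {g : (ℤ → ℝ) → ℝ} (hg : Measurable g) (hg0 : ∀ x, 0 ≤ g x)
    (hgi : Integrable (fun ω => g (pathFrom ε 0 ω)) P) :
    ∃ A : ℝ, 0 ≤ A ∧ ∀ᵐ ω ∂P, ∀ᶠ n : ℕ in atTop, g (pathFrom ε n ω) ≤ A * n := by
  have h0 : 0 ≤ ∫ ω, g (pathFrom ε 0 ω) ∂P := integral_nonneg fun ω => hg0 _
  refine ⟨∫ ω, g (pathFrom ε 0 ω) ∂P + 1, by linarith, ?_⟩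
  filter_upwards [h.ae_eventually_average_lt hε hg hgi (lt_add_one _)] with ω hω
  filter_upwards [hω, eventually_ge_atTop 1] with n hn hn1
  have hn0 : (0 : ℝ) < n := by exact_mod_cast hn1
  rw [one_div, inv_mul_lt_iff₀ hn0] at hn
  have := Finset.single_le_sum (f := fun t : ℕ => g (pathFrom ε t ω))
    (fun t _ => hg0 _) (Finset.mem_Icc.2 ⟨hn1, le_rfl⟩)
  linarith

/-- The squared observations grow at most polynomially. -/
lemma ae_exists_eventually_sq_le (h : StationaryErgodic P ε) (hε : ∀ t, Measurable (ε t))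
    {θ : EuclideanSpace ℝ (Fin r)} (hm : Measurable fun x => σ x θ) (hpos : ∀ x, 0 < σ x θ)
    {s : ℝ} (hs : 0 < s) (hmom : Integrable (fun ω => vol σ ε 0 θ ω ^ s) P)
    (hsq : Integrable (fun ω => (ε 0 ω / vol σ ε 0 θ ω) ^ 2) P) :
    ∃ (A : ℝ) (k : ℕ), ∀ᵐ ω ∂P, ∀ᶠ n : ℕ in atTop, ε n ω ^ 2 ≤ A * (n : ℝ) ^ k := by
  have hv := measurable_volAt hm
  obtain ⟨A, hA, hA'⟩ := h.ae_exists_eventually_le_mul hε (g := fun x => volAt σ x θ ^ s)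
    (hv.pow_const s) (fun x => Real.rpow_nonneg (hpos _).le s)
    (by simpa only [volAt_pathFrom] using hmom)
  obtain ⟨B, hB, hB'⟩ := h.ae_exists_eventually_le_mul hε
    (g := fun x => (x 0 / volAt σ x θ) ^ 2) (((measurable_pi_apply 0).div hv).pow_const 2)
    (fun x => sq_nonneg _) (by simpa only [volAt_pathFrom, pathFrom_zero] using hsq)
  -- With ε² = (ε/σ)²σ², the first factor is at most Bn and σ^s ≤ An. Using A + 1 keeps the base at
  -- least 1, so that 2/s may be rounded up.
  refine ⟨B * (A + 1) ^ ⌈2 / s⌉₊, ⌈2 / s⌉₊ + 1, ?_⟩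
  filter_upwards [hA', hB'] with ω h1 h2
  filter_upwards [h1, h2, eventually_ge_atTop 1] with n hn1 hn2 hn
  rw [volAt_pathFrom] at hn1
  rw [volAt_pathFrom, pathFrom_zero] at hn2
  have hn' : (1 : ℝ) ≤ n := by exact_mod_cast hn
  have hv0 : 0 < vol σ ε n θ ω := hpos _
  have hA1 : 1 ≤ (A + 1) * n := by nlinarith
  have hv2 : vol σ ε n θ ω ^ 2 ≤ ((A + 1) * n) ^ ⌈2 / s⌉₊ := by
    calc vol σ ε n θ ω ^ 2 = (vol σ ε n θ ω ^ s) ^ (2 / s) := by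
          rw [← Real.rpow_mul hv0.le, mul_div_cancel₀ _ hs.ne']
          exact (Real.rpow_natCast _ 2).symm
      _ ≤ ((A + 1) * n) ^ (2 / s) := by
          refine Real.rpow_le_rpow (Real.rpow_nonneg hv0.le s) (hn1.trans ?_) (by positivity)
          nlinarith
      _ ≤ ((A + 1) * n) ^ ((⌈2 / s⌉₊ : ℕ) : ℝ) :=
          Real.rpow_le_rpow_of_exponent_le hA1 (Nat.le_ceil _)
      _ = _ := Real.rpow_natCast _ _
  calc ε n ω ^ 2 = (ε n ω / vol σ ε n θ ω) ^ 2 * vol σ ε n θ ω ^ 2 := by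
        field_simp
    _ ≤ (B * n) * ((A + 1) * n) ^ ⌈2 / s⌉₊ := by gcongr
    _ = _ := by rw [mul_pow]; ring

end Growth

/-! ### Identification of the true parameter. -/

section Identification

variable {Ω : Type*} [MeasurableSpace Ω] {P : Measure Ω}

lemma neg_half_sq_add_half_add_log_nonpos {x : ℝ} (hx : 0 < x) :
    -(1 / 2) * x ^ 2 + 1 / 2 + Real.log x ≤ 0 := by
  have := Real.log_le_sub_one_of_pos (sq_pos_of_pos hx)
  rw [Real.log_pow] at this
  push_cast at this
  linarith

lemma eq_one_of_neg_half_sq_add_half_add_log_eq_zero {x : ℝ} (hx : 0 < x)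
    (h : -(1 / 2) * x ^ 2 + 1 / 2 + Real.log x = 0) : x = 1 := by
  by_contra hne
  have hne2 : x ^ 2 ≠ 1 := by
    intro h2
    exact hne ((pow_eq_one_iff_of_nonneg hx.le two_ne_zero).1 h2)
  have := Real.log_lt_sub_one_of_pos (sq_pos_of_pos hx) hne2
  rw [Real.log_pow] at this
  push_cast at this
  linarith

variable {e z v₀ v₁ : Ω → ℝ} {c : ℝ}

lemma gaussLogLik_ae_eq (hv₀0 : ∀ ω, 0 < v₀ ω) (he : ∀ᵐ ω ∂P, e ω = v₀ ω * z ω) :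
    (fun ω => gaussLogLik (e ω) (v₀ ω)) =ᵐ[P]
      fun ω => -(1 / 2) * z ω ^ 2 - Real.log (v₀ ω) := by
  filter_upwards [he] with ω hω
  rw [gaussLogLik, hω, mul_div_cancel_left₀ _ (hv₀0 ω).ne']

lemma integrable_gaussLogLik (hv₀0 : ∀ ω, 0 < v₀ ω)
    (he : ∀ᵐ ω ∂P, e ω = v₀ ω * z ω) (hz2 : Integrable (fun ω => z ω ^ 2) P)
    (hlog : Integrable (fun ω => Real.log (v₀ ω)) P) :
    Integrable (fun ω => gaussLogLik (e ω) (v₀ ω)) P :=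
  ((hz2.const_mul (-(1 / 2))).sub hlog).congr (gaussLogLik_ae_eq hv₀0 he).symm

variable [IsProbabilityMeasure P]

lemma integrable_log_of_rpow (hv₀ : Measurable v₀) (hc : 0 < c) (hcv : ∀ᵐ ω ∂P, c < v₀ ω) {s : ℝ}
    (hs : 0 < s) (hmom : Integrable (fun ω => v₀ ω ^ s) P) :
    Integrable (fun ω => Real.log (v₀ ω)) P := by
  refine Integrable.mono' ((hmom.div_const s).add (integrable_const |Real.log c|))
    hv₀.log.aestronglyMeasurable ?_
  filter_upwards [hcv] with ω hω
  have h0 := hc.trans hω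
  have h1 := Real.log_le_rpow_div h0.le hs
  have h2 := Real.log_le_log hc hω.le
  have h3 : 0 ≤ v₀ ω ^ s / s := by positivity
  have h4 := neg_abs_le (Real.log c)
  simp only [Pi.add_apply]
  rw [Real.norm_eq_abs, abs_le]
  constructor <;> linarith [abs_nonneg (Real.log c)]

/-- The expected Gaussian log-likelihood is maximal only at the true volatility. -/
theorem integral_gaussLogLik_lt (hv₀ : Measurable v₀) (hv₁ : Measurable v₁)
    (hz : Measurable z) (hv₀0 : ∀ ω, 0 < v₀ ω) (hv₁0 : ∀ ω, 0 < v₁ ω) (hc : 0 < c)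
    (hcv : ∀ᵐ ω ∂P, c < v₁ ω) (he : ∀ᵐ ω ∂P, e ω = v₀ ω * z ω)
    (hz2 : Integrable (fun ω => z ω ^ 2) P) (hz1 : ∫ ω, z ω ^ 2 ∂P = 1)
    (hind : IndepFun z (fun ω => v₀ ω / v₁ ω) P)
    (hlog : Integrable (fun ω => Real.log (v₀ ω)) P)
    (hne : ¬ ∀ᵐ ω ∂P, v₀ ω / v₁ ω = 1)
    (hint : Integrable (fun ω => gaussLogLik (e ω) (v₁ ω)) P) :
    ∫ ω, gaussLogLik (e ω) (v₁ ω) ∂P < ∫ ω, gaussLogLik (e ω) (v₀ ω) ∂P := by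
  have hR : Measurable fun ω => v₀ ω / v₁ ω := hv₀.div hv₁
  have heq : ∀ᵐ ω ∂P, gaussLogLik (e ω) (v₁ ω)
      = -(1 / 2) * (z ω ^ 2 * (v₀ ω / v₁ ω) ^ 2) - Real.log (v₁ ω) := by
    filter_upwards [he] with ω hω
    rw [gaussLogLik, hω]
    ring
  -- Since log v₁ ≥ log c, integrability of the likelihood controls its quadratic part;
  -- integrability of log v₁ then follows by subtraction.
  have hprod : Integrable (fun ω => z ω ^ 2 * (v₀ ω / v₁ ω) ^ 2) P := by
    refine Integrable.mono' ((hint.abs.add (integrable_const |Real.log c|)).const_mul 2)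
      ((hz.pow_const 2).mul (hR.pow_const 2)).aestronglyMeasurable ?_
    filter_upwards [heq, hcv] with ω hω hcω
    have h1 := Real.log_le_log hc hcω.le
    have h2 := neg_abs_le (gaussLogLik (e ω) (v₁ ω))
    have h3 := neg_abs_le (Real.log c)
    rw [Real.norm_of_nonneg (by positivity)]
    simp only [Pi.add_apply]
    linarith
  have hlog₁ : Integrable (fun ω => Real.log (v₁ ω)) P := by
    refine ((hprod.const_mul (-(1 / 2))).sub hint).congr ?_
    filter_upwards [heq] with ω hω
    simp only [Pi.sub_apply]
    rw [hω]
    ring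
  have hind2 : IndepFun (fun ω => z ω ^ 2) (fun ω => (v₀ ω / v₁ ω) ^ 2) P :=
    hind.comp (φ := fun x => x ^ 2) (ψ := fun x => x ^ 2) (measurable_id.pow_const 2)
      (measurable_id.pow_const 2)
  -- An integrable product of independent factors has an integrable factor when the other is not
  -- a.e. zero; here E z² = 1.
  have hR2 : Integrable (fun ω => (v₀ ω / v₁ ω) ^ 2) P := by
    refine hind2.integrable_right_of_integrable_op (fun x y => x * y) 1 one_ne_zero
      (fun x y => by simp [enorm_mul]) hprod (hz.pow_const 2).aestronglyMeasurable
      (hR.pow_const 2).aestronglyMeasurable fun h0 => ?_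
    rw [integral_congr_ae h0] at hz1
    simp at hz1
  have hmul : ∫ ω, z ω ^ 2 * (v₀ ω / v₁ ω) ^ 2 ∂P = ∫ ω, (v₀ ω / v₁ ω) ^ 2 ∂P := by
    rw [hind2.integral_fun_mul_eq_mul_integral (hz.pow_const 2).aestronglyMeasurable
      (hR.pow_const 2).aestronglyMeasurable, hz1, one_mul]
  set q : Ω → ℝ := fun ω =>
    -(1 / 2) * (v₀ ω / v₁ ω) ^ 2 + 1 / 2 + Real.log (v₀ ω / v₁ ω) with hq
  have hqlog : q = fun ω => -(1 / 2) * (v₀ ω / v₁ ω) ^ 2 + 1 / 2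
      + (Real.log (v₀ ω) - Real.log (v₁ ω)) := by
    funext ω
    rw [hq]
    simp only
    rw [Real.log_div (hv₀0 ω).ne' (hv₁0 ω).ne']
  have ha : Integrable (fun ω => -(1 / 2) * (v₀ ω / v₁ ω) ^ 2 + 1 / 2) P :=
    (hR2.const_mul (-(1 / 2))).add (integrable_const _)
  have hdiff : Integrable (fun ω => Real.log (v₀ ω) - Real.log (v₁ ω)) P := hlog.sub hlog₁
  have hqi : Integrable q P := by
    rw [hqlog]
    exact ha.add hdiff
  have hqint : ∫ ω, q ω ∂P
      = ∫ ω, gaussLogLik (e ω) (v₁ ω) ∂P - ∫ ω, gaussLogLik (e ω) (v₀ ω) ∂P := by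
    rw [integral_congr_ae heq, integral_congr_ae (gaussLogLik_ae_eq hv₀0 he),
      integral_sub (hprod.const_mul _) hlog₁, integral_sub (hz2.const_mul _) hlog,
      integral_const_mul, integral_const_mul, hmul, hz1, hqlog,
      integral_add ha hdiff, integral_sub hlog hlog₁,
      integral_add (hR2.const_mul _) (integrable_const _), integral_const_mul, integral_const,
      probReal_univ]
    simp only [smul_eq_mul]
    ring
  have hq0 : ∀ ω, q ω ≤ 0 := fun ω =>
    neg_half_sq_add_half_add_log_nonpos (div_pos (hv₀0 ω) (hv₁0 ω))
  by_contra! hle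
  have hzero : ∫ ω, -q ω ∂P = 0 := by
    rw [integral_neg]
    have := integral_nonpos (μ := P) hq0
    linarith
  rw [integral_eq_zero_iff_of_nonneg (fun ω => neg_nonneg.2 (hq0 ω)) hqi.neg] at hzero
  refine hne (hzero.mono fun ω hω => ?_)
  exact eq_one_of_neg_half_sq_add_half_add_log_eq_zero (div_pos (hv₀0 ω) (hv₁0 ω))
    (neg_eq_zero.1 hω)

end Identification

/-! ### Strong consistency. -/

section Consistency

variable {Ω : Type*} {r : ℕ}
  {Θ : Set (EuclideanSpace ℝ (Fin r))} {θ₀ : EuclideanSpace ℝ (Fin r)}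
  {σ : (ℕ → ℝ) → EuclideanSpace ℝ (Fin r) → ℝ} {ε η εtilde : ℤ → Ω → ℝ}
  {θhat : ℕ → Ω → EuclideanSpace ℝ (Fin r)}

lemma quasiLogLik_eq (n : ℕ) (θ : EuclideanSpace ℝ (Fin r)) (ω : Ω) :
    quasiLogLik σ ε εtilde n θ ω = (1 / (n : ℝ)) * ∑ t ∈ Finset.Icc 1 n,
      gaussLogLik (ε t ω) (volTilde σ ε εtilde t θ ω) := rfl

variable [MeasurableSpace Ω] {P : Measure Ω}

/-- The likelihood contributions computed from presample values are asymptotically close to the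
stationary ones, uniformly in the parameter. -/
lemma ae_exists_tendsto_zero_abs_gaussLogLik_volTilde_sub_le (hne : Θ.Nonempty)
    (hΘ : IsCompact Θ) (hpos : ∀ x, ∀ θ ∈ Θ, 0 < σ x θ)
    (h_cont : ∀ x, ContinuousOn (fun θ => σ x θ) Θ) {c : ℝ} (hc : 0 < c)
    (h_lower : ∀ t, ∀ᵐ ω ∂P, ∀ θ ∈ Θ, c < vol σ ε t θ ω) {ρ : ℝ} (hρ0 : 0 < ρ) (hρ1 : ρ < 1)
    {C₁ : Ω → ℝ} (h_init : ∀ᵐ ω ∂P, ∀ t : ℕ, 1 ≤ t → ∀ θ ∈ Θ,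
      |vol σ ε t θ ω - volTilde σ ε εtilde t θ ω| ≤ C₁ ω * ρ ^ t) {A : ℝ} {k : ℕ}
    (h_growth : ∀ᵐ ω ∂P, ∀ᶠ n : ℕ in atTop, ε n ω ^ 2 ≤ A * (n : ℝ) ^ k) :
    ∀ᵐ ω ∂P, ∃ D : ℕ → ℝ, Tendsto D atTop (𝓝 0) ∧ ∀ t : ℕ, ∀ θ ∈ Θ,
      |gaussLogLik (ε t ω) (vol σ ε t θ ω) -
        gaussLogLik (ε t ω) (volTilde σ ε εtilde t θ ω)| ≤ D t := by
  have := isCompact_iff_compactSpace.1 hΘ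
  have := hne.to_subtype
  filter_upwards [ae_all_iff.2 h_lower, h_init, h_growth] with ω h1 h2 h3
  obtain ⟨D, hD, hDle⟩ := exists_tendsto_zero_abs_gaussLogLik_sub_le (K := Θ)
    (w := fun t θ => vol σ ε t θ ω) (w' := fun t θ => volTilde σ ε εtilde t θ ω)
    (e := fun t => ε t ω) (fun t => continuousOn_iff_continuous_domRestrict.1 (h_cont _))
    (fun t => continuousOn_iff_continuous_domRestrict.1 (h_cont _)) (fun t θ => hpos _ _ θ.2)
    (fun t θ => hpos _ _ θ.2) hc (fun t θ => h1 t θ θ.2) hρ0 hρ1 (fun t ht θ => h2 t ht θ θ.2) h3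
  exact ⟨D, hD, fun t θ hθ => hDle t ⟨θ, hθ⟩⟩

/-- A parameter with strictly smaller expected log-likelihood has a neighbourhood that the
estimator eventually leaves. -/
lemma exists_nhds_ae_eventually_notMem [IsProbabilityMeasure P] (hΘ : IsCompact Θ) (hθ₀ : θ₀ ∈ Θ)
    (h_erg : StationaryErgodic P ε) (hε : ∀ t, Measurable (ε t))
    (hσ_meas : ∀ θ ∈ Θ, Measurable fun x => σ x θ)
    (hpos : ∀ x, ∀ θ ∈ Θ, 0 < σ x θ) (h_cont : ∀ x, ContinuousOn (fun θ => σ x θ) Θ) {c : ℝ}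
    (hc : 0 < c) (h_lower : ∀ᵐ ω ∂P, ∀ θ ∈ Θ, c < vol σ ε 0 θ ω)
    (happrox : ∀ᵐ ω ∂P, ∃ D : ℕ → ℝ, Tendsto D atTop (𝓝 0) ∧ ∀ t : ℕ, ∀ θ ∈ Θ,
      |gaussLogLik (ε t ω) (vol σ ε t θ ω) -
        gaussLogLik (ε t ω) (volTilde σ ε εtilde t θ ω)| ≤ D t)
    (hint₀ : Integrable (fun ω => gaussLogLik (ε 0 ω) (vol σ ε 0 θ₀ ω)) P)
    (hθhat : IsGaussianQMLE Θ σ ε εtilde θhat) {θ₁ : EuclideanSpace ℝ (Fin r)} (hθ₁ : θ₁ ∈ Θ)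
    (hlt : Integrable (fun ω => gaussLogLik (ε 0 ω) (vol σ ε 0 θ₁ ω)) P →
      ∫ ω, gaussLogLik (ε 0 ω) (vol σ ε 0 θ₁ ω) ∂P <
        ∫ ω, gaussLogLik (ε 0 ω) (vol σ ε 0 θ₀ ω) ∂P) :
    ∃ U ∈ 𝓝 θ₁, ∀ᵐ ω ∂P, ∀ᶠ n in atTop, θhat n ω ∉ U := by
  have := isCompact_iff_compactSpace.1 hΘ
  have : Nonempty Θ := ⟨⟨θ₀, hθ₀⟩⟩
  set g : (ℤ → ℝ) → Θ → ℝ := fun x θ => gaussLogLik (x 0) (volAt σ x θ) with hg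
  have hgt : ∀ t (ω : Ω) (θ : Θ), g (pathFrom ε t ω) θ = gaussLogLik (ε t ω) (vol σ ε t θ ω) := by
    intro t ω θ
    simp only [hg, volAt_pathFrom, pathFrom_zero]
  have hgm : ∀ θ, Measurable fun x => g x θ := fun θ => by
    have hv := measurable_volAt (hσ_meas θ θ.2)
    exact ((((measurable_pi_apply 0).div hv).pow_const 2).const_mul _).sub hv.log
  have hgc : ∀ x, Continuous (g x) := fun x =>
    continuous_gaussLogLik (w := fun θ : Θ => volAt σ x θ)
      (continuousOn_iff_continuous_domRestrict.1 (h_cont _)) (fun θ => hpos _ _ θ.2) _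
  obtain ⟨δ, hδ, M, hMi, hM⟩ := exists_integral_max_localSup_lt (μ := P)
    (g := fun ω => g (pathFrom ε 0 ω)) (fun θ => (hgm θ).comp (measurable_pathFrom hε 0))
    (fun ω => hgc _) (b := -Real.log c)
    (L := ∫ ω, gaussLogLik (ε 0 ω) (vol σ ε 0 θ₀ ω) ∂P)
    (by
      filter_upwards [h_lower] with ω hω θ
      rw [hgt]
      exact gaussLogLik_le _ hc (hω θ θ.2).le) ⟨θ₁, hθ₁⟩ (by simpa only [hgt] using hlt)
  obtain ⟨a, hMa, ha⟩ := exists_between hM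
  obtain ⟨b, hab, hb⟩ := exists_between ha
  have hup := h_erg.ae_eventually_average_lt hε
    (g := fun x => max (localSup g ⟨θ₁, hθ₁⟩ δ x) (-M))
    ((measurable_localSup hgm _ δ).max measurable_const) hMi hMa
  have hdown := h_erg.ae_eventually_lt_average hε (hgm ⟨θ₀, hθ₀⟩)
    (by simpa only [hgt] using hint₀) (a := b) (by simpa only [hgt] using hb)
  refine ⟨Metric.ball θ₁ δ, Metric.ball_mem_nhds _ hδ, ?_⟩
  filter_upwards [hup, hdown, happrox] with ω h1 h2 ⟨D, hD, hDle⟩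
  -- The average of `D` is paid twice, at the estimator and at `θ₀`. An estimate in the ball would
  -- give b < a + 2·(b - a)/2 = b.
  have hab2 : 0 < (b - a) / 2 := by linarith
  filter_upwards [h1, h2, (tendsto_average_Icc hD).eventually_lt_const hab2,
    eventually_ge_atTop 1] with n hn1 hn2 hn3 hn hmem
  obtain ⟨hmemΘ, hmax⟩ := (hθhat n hn).2 ω
  have hmax' := isMaxOn_iff.1 hmax θ₀ hθ₀
  simp only [quasiLogLik_eq] at hmax'
  have hn0 : (0 : ℝ) ≤ 1 / (n : ℝ) := by positivity
  have hA : (1 / (n : ℝ)) * ∑ t ∈ Finset.Icc 1 n,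
        gaussLogLik (ε t ω) (volTilde σ ε εtilde t (θhat n ω) ω)
      ≤ (1 / (n : ℝ)) * ∑ t ∈ Finset.Icc 1 n,
          max (localSup g ⟨θ₁, hθ₁⟩ δ (pathFrom ε t ω)) (-M)
        + (1 / (n : ℝ)) * ∑ t ∈ Finset.Icc 1 n, D t := by
    rw [← mul_add, ← Finset.sum_add_distrib]
    refine mul_le_mul_of_nonneg_left (Finset.sum_le_sum fun t _ => ?_) hn0
    have h3 := (abs_le.1 (hDle t _ hmemΘ)).1
    have h4 := le_localSup (hgc (pathFrom ε t ω)) (θ := ⟨θ₁, hθ₁⟩) (θ' := ⟨θhat n ω, hmemΘ⟩)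
      (δ := δ) hmem
    rw [hgt] at h4
    have h5 := le_max_left (localSup g ⟨θ₁, hθ₁⟩ δ (pathFrom ε t ω)) (-M)
    simp only at h4
    linarith
  have hB : (1 / (n : ℝ)) * ∑ t ∈ Finset.Icc 1 n, g (pathFrom ε t ω) ⟨θ₀, hθ₀⟩
      ≤ (1 / (n : ℝ)) * ∑ t ∈ Finset.Icc 1 n,
          gaussLogLik (ε t ω) (volTilde σ ε εtilde t θ₀ ω)
        + (1 / (n : ℝ)) * ∑ t ∈ Finset.Icc 1 n, D t := by
    rw [← mul_add, ← Finset.sum_add_distrib]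
    refine mul_le_mul_of_nonneg_left (Finset.sum_le_sum fun t _ => ?_) hn0
    have h3 := (abs_le.1 (hDle t _ hθ₀)).2
    rw [hgt]
    linarith
  linarith

/-- An estimator with values in a compact set that eventually leaves a neighbourhood of every
wrong parameter is strongly consistent. -/
lemma ae_tendsto_of_eventually_notMem_nhds (hΘ : IsCompact Θ)
    (hmem : ∀ n, 1 ≤ n → ∀ ω, θhat n ω ∈ Θ)
    (h : ∀ θ ∈ Θ, θ ≠ θ₀ → ∃ U ∈ 𝓝 θ, ∀ᵐ ω ∂P, ∀ᶠ n in atTop, θhat n ω ∉ U) :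
    ∀ᵐ ω ∂P, Tendsto (fun n => θhat n ω) atTop (𝓝 θ₀) := by
  choose! U hU hae using h
  -- A countable subcover leaves a single null set, off which no wrong parameter is a cluster point.
  obtain ⟨t, htΘ, htc, hcover⟩ := TopologicalSpace.countable_cover_nhdsWithin
    (s := Θ \ {θ₀}) (f := fun θ => interior (U θ))
    fun θ hθ => mem_nhdsWithin_of_mem_nhds (interior_mem_nhds.2 (hU θ hθ.1 hθ.2))
  have hall : ∀ᵐ ω ∂P, ∀ θ ∈ t, ∀ᶠ n in atTop, θhat n ω ∉ U θ :=
    (ae_ball_iff htc).2 fun θ hθ => hae θ (htΘ hθ).1 (htΘ hθ).2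
  filter_upwards [hall] with ω hω
  refine hΘ.tendsto_nhds_of_unique_mapClusterPt
    ((eventually_ge_atTop 1).mono fun n hn => hmem n hn ω) fun θ hθ hcl => ?_
  by_contra hne
  obtain ⟨θ', hθ', hθU⟩ := Set.mem_iUnion₂.1 (hcover ⟨hθ, hne⟩)
  obtain ⟨n, hn1, hn2⟩ := ((mapClusterPt_iff_frequently.1 hcl _
    (isOpen_interior.mem_nhds hθU)).and_eventually (hω θ' hθ')).exists
  exact hn2 (interior_subset hn1)

end Consistency

/-! ### Empirical distribution of the residuals. -/

section EmpiricalDistribution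

lemma measure_map_singleton_eq_zero_of_continuous_cdf {μ : Measure ℝ} [IsProbabilityMeasure μ]
    (h : Continuous fun x => cdf μ x) (y : ℝ) : μ {y} = 0 := by
  rw [← measure_cdf μ, StieltjesFunction.measure_singleton,
    leftLim_eq_of_tendsto ((h.tendsto y).mono_left nhdsWithin_le_nhds)]
  simp

lemma div_le_of_le_sub {e u b y : ℝ} (hu : 0 < u) (hub : |u - 1| ≤ b) (h : e ≤ y - |y| * b) :
    e / u ≤ y := by
  rw [div_le_iff₀ hu]
  have h1 : |y * (u - 1)| ≤ |y| * b := by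
    rw [abs_mul]
    gcongr
  linarith [(abs_le.1 h1).1]

lemma le_add_of_div_le {e u b y : ℝ} (hu : 0 < u) (hub : |u - 1| ≤ b) (h : e / u ≤ y) :
    e ≤ y + |y| * b := by
  rw [div_le_iff₀ hu] at h
  have h1 : |y * (u - 1)| ≤ |y| * b := by
    rw [abs_mul]
    gcongr
  linarith [(abs_le.1 h1).2]

lemma indicator_Iic_le_of_imp {a b x z : ℝ} (h : a ≤ x → b ≤ z) :
    Set.indicator (Set.Iic x) (fun _ => (1 : ℝ)) a
      ≤ Set.indicator (Set.Iic z) (fun _ => (1 : ℝ)) b := by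
  by_cases ha : a ≤ x
  · rw [Set.indicator_of_mem (Set.mem_Iic.2 ha), Set.indicator_of_mem (Set.mem_Iic.2 (h ha))]
  · rw [Set.indicator_of_notMem (by simpa using ha)]
    exact Set.indicator_nonneg (fun _ _ => zero_le_one) _

section Residual

variable {Ω : Type*} {r : ℕ} {Θ : Set (EuclideanSpace ℝ (Fin r))} {θ₀ : EuclideanSpace ℝ (Fin r)}
  {σ : (ℕ → ℝ) → EuclideanSpace ℝ (Fin r) → ℝ} {ε εtilde : ℤ → Ω → ℝ}
  {θhat : ℕ → Ω → EuclideanSpace ℝ (Fin r)}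

lemma continuous_abs_volAt_div_sub_one (h_cont : ∀ x, ContinuousOn (fun θ => σ x θ) Θ)
    (θ₀ : EuclideanSpace ℝ (Fin r)) (x : ℤ → ℝ) :
    Continuous fun θ : Θ => |volAt σ x θ / volAt σ x θ₀ - 1| :=
  (((continuousOn_iff_continuous_domRestrict.1 (h_cont _)).div_const _).sub
    continuous_const).abs

/-- The largest relative deviation of the volatility from its true value over a ball around the
true parameter. -/
noncomputable def volDeviation (σ : (ℕ → ℝ) → EuclideanSpace ℝ (Fin r) → ℝ)
    (Θ : Set (EuclideanSpace ℝ (Fin r))) [CompactSpace Θ] [Nonempty Θ] (θ₀ : Θ) (δ : ℝ)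
    (x : ℤ → ℝ) : ℝ :=
  localSup (fun x (θ : Θ) => |volAt σ x θ / volAt σ x θ₀ - 1|) θ₀ δ x

/-- All but finitely many residuals are close to the innovations, up to a relative error
bounded by the local deviation of the volatility. -/
lemma exists_tendsto_zero_indicator_qmlResidual [CompactSpace Θ] [Nonempty Θ] (hθ₀ : θ₀ ∈ Θ)
    (hpos : ∀ x, ∀ θ ∈ Θ, 0 < σ x θ) (h_cont : ∀ x, ContinuousOn (fun θ => σ x θ) Θ) {c C : ℝ}
    (hc : 0 < c) {ω : Ω} (h_lower : ∀ t, c < vol σ ε t θ₀ ω) {ρ : ℝ} (hρ0 : 0 < ρ) (hρ1 : ρ < 1)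
    (h_init : ∀ t : ℕ, 1 ≤ t → ∀ θ ∈ Θ,
      |vol σ ε t θ ω - volTilde σ ε εtilde t θ ω| ≤ C * ρ ^ t)
    (hmem : ∀ n, 1 ≤ n → θhat n ω ∈ Θ) (hcons : Tendsto (fun n => θhat n ω) atTop (𝓝 θ₀)) (y : ℝ)
    {τ : ℝ} (hτ : 0 < τ) :
    ∃ D : ℕ → ℝ, Tendsto D atTop (𝓝 0) ∧ ∀ᶠ n in atTop, ∀ t : ℕ, 1 ≤ t →
      Set.indicator (Set.Iic y) (fun _ => (1 : ℝ)) (qmlResidual σ ε εtilde θhat n t ω) ≤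
        Set.indicator (Set.Iic (y + |y| * (volDeviation σ Θ ⟨θ₀, hθ₀⟩ τ (pathFrom ε t ω) + τ)))
          (fun _ => (1 : ℝ)) (pathFrom ε t ω 0 / volAt σ (pathFrom ε t ω) θ₀) + D t ∧
      Set.indicator (Set.Iic (y + -|y| * (volDeviation σ Θ ⟨θ₀, hθ₀⟩ τ (pathFrom ε t ω) + τ)))
          (fun _ => (1 : ℝ)) (pathFrom ε t ω 0 / volAt σ (pathFrom ε t ω) θ₀) ≤
        Set.indicator (Set.Iic y) (fun _ => (1 : ℝ)) (qmlResidual σ ε εtilde θhat n t ω)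
          + D t := by
  have hpow : Tendsto (fun t : ℕ => C * ρ ^ t / c) atTop (𝓝 0) := by
    simpa using ((tendsto_pow_atTop_nhds_zero_of_lt_one hρ0.le hρ1).const_mul C).div_const c
  obtain ⟨T, hT⟩ := eventually_atTop.1 (hpow.eventually_lt_const hτ)
  -- An error of 1 makes both indicator bounds trivial for early t; from `T` on the presample error,
  -- relative to the volatility, is below `τ`.
  refine ⟨fun t => if t < T then 1 else 0, tendsto_const_nhds.congr' ?_, ?_⟩
  · filter_upwards [eventually_ge_atTop T] with t ht
    rw [if_neg (not_lt.2 ht)]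
  filter_upwards [hcons.eventually (Metric.ball_mem_nhds θ₀ hτ), eventually_ge_atTop 1]
    with n hn hn1 t ht
  rcases lt_or_ge t T with htT | htT
  · simp only [htT, if_true, Set.indicator_apply]
    constructor <;> split_ifs <;> norm_num
  have hv : 0 < vol σ ε t θ₀ ω := hpos _ _ hθ₀
  have hu : 0 < volTilde σ ε εtilde t (θhat n ω) ω / vol σ ε t θ₀ ω :=
    div_pos (hpos _ _ (hmem n hn1)) hv
  -- Dividing by a factor within `b` of 1 moves the threshold y by at most |y|·b.
  have hres : qmlResidual σ ε εtilde θhat n t ω = ε t ω / vol σ ε t θ₀ ω /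
      (volTilde σ ε εtilde t (θhat n ω) ω / vol σ ε t θ₀ ω) := by
    rw [qmlResidual, div_div_div_cancel_right₀ hv.ne']
  have h4 : |vol σ ε t (θhat n ω) ω / vol σ ε t θ₀ ω - 1|
      ≤ volDeviation σ Θ ⟨θ₀, hθ₀⟩ τ (pathFrom ε t ω) := by
    have := le_localSup (g := fun x (θ : Θ) => |volAt σ x θ / volAt σ x θ₀ - 1|)
      (x := pathFrom ε t ω) (continuous_abs_volAt_div_sub_one h_cont θ₀ _) (θ := ⟨θ₀, hθ₀⟩)
      (θ' := ⟨θhat n ω, hmem n hn1⟩) (δ := τ) hn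
    simp only [volAt_pathFrom] at this
    exact this
  have h5 : |volTilde σ ε εtilde t (θhat n ω) ω / vol σ ε t θ₀ ω
      - vol σ ε t (θhat n ω) ω / vol σ ε t θ₀ ω| ≤ τ := by
    rw [← sub_div, abs_div, abs_of_pos hv, abs_sub_comm]
    calc |vol σ ε t (θhat n ω) ω - volTilde σ ε εtilde t (θhat n ω) ω| / vol σ ε t θ₀ ω
        ≤ |vol σ ε t (θhat n ω) ω - volTilde σ ε εtilde t (θhat n ω) ω| / c := by
          gcongr
          exact (h_lower t).le
      _ ≤ C * ρ ^ t / c := by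
          gcongr
          exact h_init t ht _ (hmem n hn1)
      _ ≤ τ := (hT t htT).le
  have hub : |volTilde σ ε εtilde t (θhat n ω) ω / vol σ ε t θ₀ ω - 1|
      ≤ volDeviation σ Θ ⟨θ₀, hθ₀⟩ τ (pathFrom ε t ω) + τ := by
    refine (abs_sub_le _ (vol σ ε t (θhat n ω) ω / vol σ ε t θ₀ ω) _).trans ?_
    rw [add_comm]
    exact add_le_add h4 h5
  rw [if_neg (not_lt.2 htT), add_zero, add_zero, volAt_pathFrom, pathFrom_zero, hres]
  refine ⟨indicator_Iic_le_of_imp fun h => le_add_of_div_le hu hub h,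
    indicator_Iic_le_of_imp fun h => div_le_of_le_sub hu hub ?_⟩
  linarith

end Residual

variable {Ω : Type*} [MeasurableSpace Ω] {P : Measure Ω} [IsProbabilityMeasure P]

/-- Where `Y ≠ y` the indicator is eventually constant in k; the absence of an atom at y makes this
almost sure. -/
lemma tendsto_integral_indicator_Iic {Y : Ω → ℝ} {b : ℕ → Ω → ℝ} {y : ℝ} (hY : Measurable Y)
    (hb : ∀ k, Measurable (b k)) (hlim : ∀ ω, Tendsto (fun k => b k ω) atTop (𝓝 y))
    (hy : ∀ᵐ ω ∂P, Y ω ≠ y) :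
    Tendsto (fun k => ∫ ω, Set.indicator (Set.Iic (b k ω)) (fun _ => (1 : ℝ)) (Y ω) ∂P) atTop
      (𝓝 (∫ ω, Set.indicator (Set.Iic y) (fun _ => (1 : ℝ)) (Y ω) ∂P)) := by
  refine tendsto_integral_of_dominated_convergence (fun _ => 1) (fun k => ?_)
    (integrable_const _) (fun k => Eventually.of_forall fun ω => ?_) ?_
  · exact ((measurable_const (a := (1 : ℝ))).indicator
      (measurableSet_le hY (hb k))).aestronglyMeasurable
  · rw [Set.indicator_apply]
    split_ifs <;> simp
  · filter_upwards [hy] with ω hω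
    refine tendsto_const_nhds.congr' ?_
    rcases lt_or_gt_of_ne hω with h | h
    · filter_upwards [(hlim ω).eventually_const_lt h] with k hk
      rw [Set.indicator_of_mem (Set.mem_Iic.2 h.le), Set.indicator_of_mem (Set.mem_Iic.2 hk.le)]
    · filter_upwards [(hlim ω).eventually_lt_const h] with k hk
      rw [Set.indicator_of_notMem (by simpa using h), Set.indicator_of_notMem (by simpa using hk)]

/-- The empirical average of indicators is asymptotically squeezed between ergodic averages. -/
theorem ae_tendsto_average_indicator {ε : ℤ → Ω → ℝ} (h_erg : StationaryErgodic P ε)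
    (hε : ∀ t, Measurable (ε t)) {e : (ℤ → ℝ) → ℝ} (he : Measurable e)
    {dev : ℕ → (ℤ → ℝ) → ℝ} (hdev : ∀ k, Measurable (dev k))
    (hlim : ∀ x, Tendsto (fun k => dev k x) atTop (𝓝 0)) {y F : ℝ}
    (hy : ∀ᵐ ω ∂P, e (pathFrom ε 0 ω) ≠ y)
    (hF : ∫ ω, Set.indicator (Set.Iic y) (fun _ => (1 : ℝ)) (e (pathFrom ε 0 ω)) ∂P = F)
    {res : ℕ → ℕ → Ω → ℝ} (hclose : ∀ k, ∀ᵐ ω ∂P, ∃ D : ℕ → ℝ, Tendsto D atTop (𝓝 0) ∧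
      ∀ᶠ n in atTop, ∀ t : ℕ, 1 ≤ t →
        Set.indicator (Set.Iic y) (fun _ => (1 : ℝ)) (res n t ω) ≤
          Set.indicator (Set.Iic (y + |y| * dev k (pathFrom ε t ω)))
            (fun _ => (1 : ℝ)) (e (pathFrom ε t ω)) + D t ∧
        Set.indicator (Set.Iic (y + -|y| * dev k (pathFrom ε t ω)))
            (fun _ => (1 : ℝ)) (e (pathFrom ε t ω)) ≤
          Set.indicator (Set.Iic y) (fun _ => (1 : ℝ)) (res n t ω) + D t) :
    ∀ᵐ ω ∂P, Tendsto (fun n : ℕ => (1 / (n : ℝ)) * ∑ t ∈ Finset.Icc 1 n,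
      Set.indicator (Set.Iic y) (fun _ => (1 : ℝ)) (res n t ω)) atTop (𝓝 F) := by
  -- The slope `d` is |y| for the upper bound and -|y| for the lower one.
  set g : ℝ → ℕ → (ℤ → ℝ) → ℝ := fun d k x =>
    Set.indicator (Set.Iic (y + d * dev k x)) (fun _ => (1 : ℝ)) (e x) with hg
  have hgm : ∀ d k, Measurable (g d k) := fun d k =>
    (measurable_const (a := (1 : ℝ))).indicator
      (measurableSet_le he (((hdev k).const_mul d).const_add y))
  have hgi : ∀ d k, Integrable (fun ω => g d k (pathFrom ε 0 ω)) P := fun d k => by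
    refine Integrable.of_bound
      ((hgm d k).comp (measurable_pathFrom hε 0)).aestronglyMeasurable 1
      (Eventually.of_forall fun ω => ?_)
    simp only [hg, Set.indicator_apply]
    split_ifs <;> simp
  have hglim : ∀ d, Tendsto (fun k => ∫ ω, g d k (pathFrom ε 0 ω) ∂P) atTop (𝓝 F) := fun d => by
    rw [← hF]
    refine tendsto_integral_indicator_Iic (he.comp (measurable_pathFrom hε 0))
      (b := fun k ω => y + d * dev k (pathFrom ε 0 ω)) (fun k => ?_) (fun ω => ?_) hy
    · exact (((hdev k).comp (measurable_pathFrom hε 0)).const_mul d).const_add y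
    · simpa using ((hlim (pathFrom ε 0 ω)).const_mul d).const_add y
  have hupper : ∀ j : ℕ, ∀ᵐ ω ∂P, ∀ᶠ n : ℕ in atTop, (1 / (n : ℝ)) * ∑ t ∈ Finset.Icc 1 n,
      Set.indicator (Set.Iic y) (fun _ => (1 : ℝ)) (res n t ω) < F + 2 * (1 / ((j : ℝ) + 1)) := by
    intro j
    have hj : 0 < 1 / ((j : ℝ) + 1) := by positivity
    obtain ⟨k, hk⟩ := ((hglim |y|).eventually_lt_const (lt_add_of_pos_right F hj)).exists
    filter_upwards [h_erg.ae_eventually_average_lt hε (hgm _ _) (hgi _ _) hk, hclose k]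
      with ω h1 ⟨D, hD, h2⟩
    filter_upwards [h1, h2, (tendsto_average_Icc hD).eventually_lt_const hj] with n hn1 hn2 hn3
    have hsum := mul_le_mul_of_nonneg_left (Finset.sum_le_sum fun t (ht : t ∈ Finset.Icc 1 n) =>
      (hn2 t (Finset.mem_Icc.1 ht).1).1) (show (0 : ℝ) ≤ 1 / (n : ℝ) by positivity)
    rw [Finset.sum_add_distrib, mul_add] at hsum
    linarith
  have hlower : ∀ j : ℕ, ∀ᵐ ω ∂P, ∀ᶠ n : ℕ in atTop, F - 2 * (1 / ((j : ℝ) + 1)) <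
      (1 / (n : ℝ)) * ∑ t ∈ Finset.Icc 1 n,
        Set.indicator (Set.Iic y) (fun _ => (1 : ℝ)) (res n t ω) := by
    intro j
    have hj : 0 < 1 / ((j : ℝ) + 1) := by positivity
    obtain ⟨k, hk⟩ := ((hglim (-|y|)).eventually_const_lt (sub_lt_self F hj)).exists
    filter_upwards [h_erg.ae_eventually_lt_average hε (hgm _ _) (hgi _ _) hk, hclose k]
      with ω h1 ⟨D, hD, h2⟩
    filter_upwards [h1, h2, (tendsto_average_Icc hD).eventually_lt_const hj] with n hn1 hn2 hn3
    have hsum := mul_le_mul_of_nonneg_left (Finset.sum_le_sum fun t (ht : t ∈ Finset.Icc 1 n) =>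
      (hn2 t (Finset.mem_Icc.1 ht).1).2) (show (0 : ℝ) ≤ 1 / (n : ℝ) by positivity)
    rw [Finset.sum_add_distrib, mul_add] at hsum
    linarith
  have hzero : Tendsto (fun j : ℕ => 2 * (1 / ((j : ℝ) + 1))) atTop (𝓝 0) := by
    simpa using (tendsto_one_div_add_atTop_nhds_zero_nat (𝕜 := ℝ)).const_mul 2
  filter_upwards [ae_all_iff.2 hupper, ae_all_iff.2 hlower] with ω h1 h2
  rw [tendsto_order]
  refine ⟨fun a ha => ?_, fun a ha => ?_⟩
  · obtain ⟨j, hj⟩ := (hzero.eventually_lt_const (sub_pos.2 ha)).exists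
    filter_upwards [h2 j] with n hn
    linarith
  · obtain ⟨j, hj⟩ := (hzero.eventually_lt_const (sub_pos.2 ha)).exists
    filter_upwards [h1 j] with n hn
    linarith

variable {r : ℕ} {Θ : Set (EuclideanSpace ℝ (Fin r))} {θ₀ : EuclideanSpace ℝ (Fin r)}
  {σ : (ℕ → ℝ) → EuclideanSpace ℝ (Fin r) → ℝ} {ε η εtilde : ℤ → Ω → ℝ}
  {θhat : ℕ → Ω → EuclideanSpace ℝ (Fin r)}

/-- The empirical distribution function of the residuals converges at every point. -/
theorem ae_tendsto_residualEdf (hΘ : IsCompact Θ) (hθ₀ : θ₀ ∈ Θ)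
    (h_erg : StationaryErgodic P ε) (hε : ∀ t, Measurable (ε t)) (hη : Measurable (η 0))
    (h_model : ∀ᵐ ω ∂P, ε 0 ω = vol σ ε 0 θ₀ ω * η 0 ω)
    (hσ_meas : ∀ θ ∈ Θ, Measurable fun x => σ x θ)
    (hpos : ∀ x, ∀ θ ∈ Θ, 0 < σ x θ) (h_cont : ∀ x, ContinuousOn (fun θ => σ x θ) Θ) {c : ℝ}
    (hc : 0 < c) (h_lower : ∀ t, ∀ᵐ ω ∂P, ∀ θ ∈ Θ, c < vol σ ε t θ ω) {ρ : ℝ} (hρ0 : 0 < ρ)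
    (hρ1 : ρ < 1) {C₁ : Ω → ℝ} (h_init : ∀ᵐ ω ∂P, ∀ t : ℕ, 1 ≤ t → ∀ θ ∈ Θ,
      |vol σ ε t θ ω - volTilde σ ε εtilde t θ ω| ≤ C₁ ω * ρ ^ t)
    (h_cdf : Continuous fun x : ℝ => cdf (P.map (η 0)) x)
    (hmem : ∀ n, 1 ≤ n → ∀ ω, θhat n ω ∈ Θ)
    (hcons : ∀ᵐ ω ∂P, Tendsto (fun n => θhat n ω) atTop (𝓝 θ₀)) (y : ℝ) :
    ∀ᵐ ω ∂P, Tendsto (fun n => residualEdf σ ε εtilde θhat n ω y) atTop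
      (𝓝 (cdf (P.map (η 0)) y)) := by
  have := isCompact_iff_compactSpace.1 hΘ
  have : Nonempty Θ := ⟨⟨θ₀, hθ₀⟩⟩
  have : IsProbabilityMeasure (P.map (η 0)) := Measure.isProbabilityMeasure_map hη.aemeasurable
  have hv₀ := measurable_volAt (hσ_meas θ₀ hθ₀)
  have heη : ∀ᵐ ω ∂P, pathFrom ε 0 ω 0 / volAt σ (pathFrom ε 0 ω) θ₀ = η 0 ω := by
    filter_upwards [h_model] with ω hω
    have hv : vol σ ε 0 θ₀ ω ≠ 0 := (hpos _ _ hθ₀).ne'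
    rw [volAt_pathFrom, pathFrom_zero, hω, mul_div_cancel_left₀ _ hv]
  refine ae_tendsto_average_indicator h_erg hε (e := fun x => x 0 / volAt σ x θ₀)
    ((measurable_pi_apply 0).div hv₀)
    (dev := fun k x => volDeviation σ Θ ⟨θ₀, hθ₀⟩ (1 / ((k : ℝ) + 1)) x + 1 / ((k : ℝ) + 1))
    (fun k => ?_) (fun x => ?_) ?_ ?_ (res := fun n t ω => qmlResidual σ ε εtilde θhat n t ω)
    fun k => ?_
  · refine (measurable_localSup (fun θ => ?_) _ _).add_const _
    exact measurable_norm.comp (((measurable_volAt (hσ_meas θ θ.2)).div hv₀).sub_const 1)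
  · have h := (tendsto_localSup (g := fun x (θ : Θ) => |volAt σ x θ / volAt σ x θ₀ - 1|) (x := x)
      (continuous_abs_volAt_div_sub_one h_cont θ₀ x) ⟨θ₀, hθ₀⟩).add
        (tendsto_one_div_add_atTop_nhds_zero_nat (𝕜 := ℝ))
    have h0 : volAt σ x θ₀ ≠ 0 := (hpos _ _ hθ₀).ne'
    have h1 : |volAt σ x θ₀ / volAt σ x θ₀ - 1| + 0 = 0 := by simp [div_self h0]
    simp only [h1] at h
    exact h
  · have h1 : ∀ᵐ ω ∂P, η 0 ω ≠ y := by
      refine ae_of_ae_map hη.aemeasurable (p := fun z => z ≠ y) ?_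
      rw [ae_iff]
      simpa using measure_map_singleton_eq_zero_of_continuous_cdf h_cdf y
    filter_upwards [h1, heη] with ω h1 h2
    rwa [h2]
  · rw [integral_congr_ae (g := fun ω => Set.indicator (Set.Iic y) (fun _ => (1 : ℝ)) (η 0 ω))
      (heη.mono fun ω hω => by simp only [hω]), cdf_eq_real,
      ← integral_map (f := Set.indicator (Set.Iic y) (fun _ => (1 : ℝ))) hη.aemeasurable
        (measurable_const.indicator measurableSet_Iic).aestronglyMeasurable]
    exact integral_indicator_one measurableSet_Iic
  · filter_upwards [ae_all_iff.2 h_lower, h_init, hcons] with ω h1 h2 h3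
    exact exists_tendsto_zero_indicator_qmlResidual hθ₀ hpos h_cont hc (fun t => h1 t θ₀ hθ₀)
      hρ0 hρ1 h2 (fun n hn => hmem n hn ω) h3 y (by positivity)

end EmpiricalDistribution

/-! ### Shape of the empirical distribution function and the main theorem. -/

section Main

variable {Ω : Type*} {r : ℕ} {σ : (ℕ → ℝ) → EuclideanSpace ℝ (Fin r) → ℝ}
  {ε εtilde : ℤ → Ω → ℝ} {θhat : ℕ → Ω → EuclideanSpace ℝ (Fin r)}

lemma monotone_residualEdf (n : ℕ) (ω : Ω) : Monotone (residualEdf σ ε εtilde θhat n ω) := by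
  intro x y hxy
  refine mul_le_mul_of_nonneg_left (Finset.sum_le_sum fun t _ => ?_) (by positivity)
  exact indicator_Iic_le_of_imp fun h => h.trans hxy

lemma residualEdf_nonneg (n : ℕ) (ω : Ω) (x : ℝ) : 0 ≤ residualEdf σ ε εtilde θhat n ω x :=
  mul_nonneg (by positivity) (Finset.sum_nonneg fun _ _ =>
    Set.indicator_nonneg (fun _ _ => zero_le_one) _)

lemma residualEdf_le_one (n : ℕ) (ω : Ω) (x : ℝ) : residualEdf σ ε εtilde θhat n ω x ≤ 1 := by
  have h : ∑ t ∈ Finset.Icc 1 n, Set.indicator (Set.Iic x) (fun _ => (1 : ℝ))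
      (qmlResidual σ ε εtilde θhat n t ω) ≤ n := by
    refine (Finset.sum_le_card_nsmul _ _ 1 fun t _ => ?_).trans (by simp)
    exact Set.indicator_le_self' (fun _ _ => zero_le_one) _
  rw [residualEdf, one_div]
  -- For n = 0 the factor 1/n is 0 by convention.
  rcases Nat.eq_zero_or_pos n with rfl | hn
  · simp
  · rw [inv_mul_le_iff₀ (by exact_mod_cast hn), mul_one]
    exact h

end Main

theorem theorem4p1
    {Ω : Type*} [MeasurableSpace Ω] (P : Measure Ω) [IsProbabilityMeasure P] {r : ℕ}
    -- parameter space, true parameter and volatility function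
    (Θ : Set (EuclideanSpace ℝ (Fin r))) (θ₀ : EuclideanSpace ℝ (Fin r)) (hθ₀ : θ₀ ∈ Θ)
    (σ : (ℕ → ℝ) → EuclideanSpace ℝ (Fin r) → ℝ)
    (hσ_meas : ∀ θ ∈ Θ, Measurable fun x => σ x θ)
    (hσ_pos : ∀ x, ∀ θ ∈ Θ, 0 < σ x θ)
    -- observations, innovations and presample values
    (ε η : ℤ → Ω → ℝ) (hε : ∀ t, Measurable (ε t)) (hη : ∀ t, Measurable (η t))
    (εtilde : ℤ → Ω → ℝ)
    -- compactness
    (hΘ : IsCompact Θ)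
    -- stationary and ergodic solution of the model
    (h_erg : StationaryErgodic P ε)
    (h_model : ∀ t, ∀ᵐ ω ∂P, ε t ω = vol σ ε t θ₀ ω * η t ω)
    -- volatility process
    (h_cont : ∀ x, ContinuousOn (fun θ => σ x θ) Θ)
    (h_lower : ∃ c : ℝ, 0 < c ∧ ∀ t, ∀ᵐ ω ∂P, ∀ θ ∈ Θ, c < vol σ ε t θ ω)
    (h_moment : ∃ s : ℝ, 0 < s ∧ ∀ t, Integrable (fun ω => vol σ ε t θ₀ ω ^ s) P)
    (h_ident : ∀ t, ∀ θ ∈ Θ, (∀ᵐ ω ∂P, vol σ ε t θ₀ ω / vol σ ε t θ ω = 1) ↔ θ = θ₀)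
    -- initial conditions
    (h_init : ∃ ρ : ℝ, 0 < ρ ∧ ρ < 1 ∧ ∃ C₁ : Ω → ℝ, Measurable[pastSigma ε 0] C₁ ∧
      (∃ s : ℝ, 0 < s ∧ Integrable (fun ω => |C₁ ω| ^ s) P) ∧
      ∀ᵐ ω ∂P, ∀ t : ℕ, 1 ≤ t → ∀ θ ∈ Θ,
        |vol σ ε t θ ω - volTilde σ ε εtilde t θ ω| ≤ C₁ ω * ρ ^ t)
    -- iid innovations with continuous cdf and unit second moment, independent of the past
    (h_indep : iIndepFun η P)
    (h_ident_distrib : ∀ t, IdentDistrib (η t) (η 0) P P)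
    (h_cdf : Continuous fun x : ℝ => cdf (P.map (η 0)) x)
    (h_sq_int : ∀ t, Integrable (fun ω => η t ω ^ 2) P)
    (h_sq : ∀ t, ∫ ω, η t ω ^ 2 ∂P = 1)
    (h_past : ∀ t, Indep (MeasurableSpace.comap (η t) inferInstance) (pastSigma ε (t - 1)) P)
    -- the estimator
    (θhat : ℕ → Ω → EuclideanSpace ℝ (Fin r)) (hθhat : IsGaussianQMLE Θ σ ε εtilde θhat) :
    (∀ᵐ ω ∂P, Tendsto (fun n => θhat n ω) atTop (𝓝 θ₀)) ∧
    (θ₀ ∈ interior Θ →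
      (∃ V ∈ 𝓝 θ₀, V ⊆ Θ ∧
        ∀ t, ∫⁻ ω, ⨆ θ ∈ V, ENNReal.ofReal (vol σ ε t θ ω / vol σ ε t θ₀ ω) ∂P < ⊤) →
      (∀ᵐ ω ∂P, Tendsto
        (fun n => ⨆ x : ℝ, |residualEdf σ ε εtilde θhat n ω x - cdf (P.map (η 0)) x|)
        atTop (𝓝 0)) ∧
      ∀ α : ℝ, 0 < α → α < 1 →
        -- the `α`-quantile of the innovations is unique
        (∀ x : ℝ, genInv (cdf (P.map (η 0))) α < x → α < cdf (P.map (η 0)) x) →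
        (∀ ξhat : ℕ → Ω → ℝ, IsResidualQuantile σ ε εtilde θhat α ξhat →
          ∀ᵐ ω ∂P, Tendsto (fun n => ξhat n ω) atTop (𝓝 (genInv (cdf (P.map (η 0))) α))) ∧
        (∀ᵐ ω ∂P, Tendsto (fun n => genInv (residualEdf σ ε εtilde θhat n ω) α) atTop
          (𝓝 (genInv (cdf (P.map (η 0))) α)))) := by
  obtain ⟨c, hc, h_low⟩ := h_lower
  obtain ⟨s, hs, hmom⟩ := h_moment
  obtain ⟨ρ, hρ0, hρ1, C₁, -, -, hinit⟩ := h_init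
  have hv₀0 : ∀ ω, 0 < vol σ ε 0 θ₀ ω := fun ω => hσ_pos _ _ hθ₀
  have hv₀ := measurable_vol hε (hσ_meas θ₀ hθ₀) 0
  have hsq : Integrable (fun ω => (ε 0 ω / vol σ ε 0 θ₀ ω) ^ 2) P := by
    refine (h_sq_int 0).congr ?_
    filter_upwards [h_model 0] with ω hω
    rw [hω, mul_div_cancel_left₀ _ (hv₀0 ω).ne']
  obtain ⟨A, k, hgrowth⟩ := ae_exists_eventually_sq_le h_erg hε (hσ_meas θ₀ hθ₀)
    (fun x => hσ_pos x θ₀ hθ₀) hs (hmom 0) hsq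
  have happrox := ae_exists_tendsto_zero_abs_gaussLogLik_volTilde_sub_le ⟨θ₀, hθ₀⟩ hΘ hσ_pos
    h_cont hc h_low hρ0 hρ1 hinit hgrowth
  have hlog : Integrable (fun ω => Real.log (vol σ ε 0 θ₀ ω)) P :=
    integrable_log_of_rpow hv₀ hc ((h_low 0).mono fun ω hω => hω θ₀ hθ₀) hs (hmom 0)
  have hmem : ∀ n, 1 ≤ n → ∀ ω, θhat n ω ∈ Θ := fun n hn ω => ((hθhat n hn).2 ω).1
  have hcons : ∀ᵐ ω ∂P, Tendsto (fun n => θhat n ω) atTop (𝓝 θ₀) := by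
    refine ae_tendsto_of_eventually_notMem_nhds hΘ hmem fun θ hθ hne => ?_
    refine exists_nhds_ae_eventually_notMem hΘ hθ₀ h_erg hε hσ_meas hσ_pos h_cont hc (h_low 0)
      happrox (integrable_gaussLogLik hv₀0 (h_model 0) (h_sq_int 0) hlog) hθhat hθ ?_
    refine integral_gaussLogLik_lt hv₀ (measurable_vol hε (hσ_meas θ hθ) 0) (hη 0) hv₀0
      (fun ω => hσ_pos _ _ hθ) hc ((h_low 0).mono fun ω hω => hω θ hθ) (h_model 0) (h_sq_int 0)
      (h_sq 0) ?_ hlog fun h => hne ((h_ident 0 θ hθ).1 h)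
    -- The volatility ratio at time 0 depends only on observations before time 0, hence is
    -- independent of `η 0`.
    exact indep_of_indep_of_le_right (h_past 0)
      ((measurable_vol_pastSigma (hσ_meas θ₀ hθ₀) 0).div
        (measurable_vol_pastSigma (hσ_meas θ hθ) 0)).comap_le
  refine ⟨hcons, fun _ _ => ?_⟩
  have hunif : ∀ᵐ ω ∂P, ∀ δ : ℝ, 0 < δ → ∀ᶠ n in atTop, ∀ x,
      |residualEdf σ ε εtilde θhat n ω x - cdf (P.map (η 0)) x| ≤ δ := by
    -- Rational points suffice for Pólya's theorem and cost only one null set.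
    have hpt : ∀ᵐ ω ∂P, ∀ q : ℚ, Tendsto (fun n => residualEdf σ ε εtilde θhat n ω q) atTop
        (𝓝 (cdf (P.map (η 0)) q)) := ae_all_iff.2 fun q =>
      ae_tendsto_residualEdf hΘ hθ₀ h_erg hε (hη 0) (h_model 0) hσ_meas hσ_pos h_cont hc h_low
        hρ0 hρ1 hinit h_cdf hmem hcons q
    filter_upwards [hpt] with ω hω δ hδ
    exact eventually_forall_abs_sub_le_of_tendsto_rat (fun n => monotone_residualEdf n ω)
      (fun n => residualEdf_nonneg n ω) (fun n => residualEdf_le_one n ω) (monotone_cdf _) h_cdf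
      (tendsto_cdf_atBot _) (tendsto_cdf_atTop _) hω hδ
  have hpoint : ∀ᵐ ω ∂P, ∀ x, Tendsto (fun n => residualEdf σ ε εtilde θhat n ω x) atTop
      (𝓝 (cdf (P.map (η 0)) x)) := by
    filter_upwards [hunif] with ω hω x
    refine Metric.tendsto_atTop'.2 fun δ hδ => ?_
    obtain ⟨N, hN⟩ := eventually_atTop.1 (hω (δ / 2) (half_pos hδ))
    refine ⟨N, fun n hn => ?_⟩
    rw [Real.dist_eq]
    linarith [hN n hn.le x]
  refine ⟨?_, fun α hα0 hα1 huniq => ?_⟩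
  · filter_upwards [hunif] with ω hω
    refine Metric.tendsto_atTop'.2 fun δ hδ => ?_
    obtain ⟨N, hN⟩ := eventually_atTop.1 (hω (δ / 2) (half_pos hδ))
    refine ⟨N, fun n hn => ?_⟩
    rw [Real.dist_eq, sub_zero, abs_of_nonneg (Real.iSup_nonneg fun x => abs_nonneg _)]
    linarith [ciSup_le (hN n hn.le)]
  have hlow : ∀ x < genInv (cdf (P.map (η 0))) α, cdf (P.map (η 0)) x < α := fun x hx =>
    lt_of_lt_genInv (tendsto_cdf_atBot _) hα0 hx
  refine ⟨fun ξhat hξ => ?_, ?_⟩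
  · filter_upwards [hpoint] with ω hω
    refine tendsto_quantile hω hlow huniq ?_
    filter_upwards [eventually_ge_atTop 1] with n hn
    exact isQuantileOf_of_isMinOn_checkLoss hn
      (fun t => qmlResidual σ ε εtilde θhat n t ω) (hξ n hn ω)
  · filter_upwards [hpoint] with ω hω
    refine tendsto_quantile hω hlow huniq ?_
    -- At distance 1 on either side of the limit quantile the empirical distribution function
    -- eventually straddles α strictly.
    filter_upwards [(hω _).eventually_lt_const (hlow _ (sub_one_lt _)),
      (hω _).eventually_const_lt (huniq _ (lt_add_one _))] with n hn1 hn2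
    exact isQuantileOf_genInv (monotone_residualEdf n ω) hn1 hn2
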